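/- Let $M$ be a connected smooth ($C^\infty$) finite-dimensional manifold (Hausdorff, second countable), possibly non-compact and with or without boundary. Let $F$ be a smooth vector field on $M$ tangent to $\partial M$, let $\Sigma=\{x\in M: F(x)=0\}$ be its set of singular points, and let $\Phi:D\to M$ be its smooth local flow: $D\subset M\times\mathbb R$ is an open neighbourhood of $M\times 0$ and, for each $x$, $t\mapsto\Phi(x,t)$ is the maximal integral curve of $F$ with $\Phi(x,0)=x$ (for a global flow, $D=M\times\mathbb R$). The orbit of $x$ is $\{\Phi(x,t):(x,t)\in D\}$. For an open subset $V\subset M$ define: * $\operatorname{im} Sh_V\subset C^\infty(V,M)$, the set of all maps of the form $x\mapsto\Phi(x,\alpha(x))$, where $\alpha\in C^\infty(V,\mathbb R)$ is such that $(x,\alpha(x))\in D$ for all $x\in V$; * $\mathcal E(F,V)\subset C^\infty(V,M)$, the set of all smooth maps $h:V\to M$ such that $h(o\cap V)\subset o$ for every orbit $o$ of $F$, and $h$ is a local diffeomorphism at every point of $V\cap\Sigma$; * $\mathcal E_{\mathrm{id}}(F,V)^k$ for $k\in\{0,1,2,\dots,\infty\}$, the path component of the inclusion $i_V:V\subset M$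 in $\mathcal E(F,V)$ with respect to the weak $C^k$ topology of $C^\infty(V,M)$ (uniform convergence on compact sets, in charts, of all derivatives of order at most $k$; for $k=\infty$, the topology generated by the weak $C^l$ topologies for all $l<\infty$). Let $V\subset M$ be open and connected, such that $V\cap\Sigma$ is nowhere dense in $V$ and, for some $k\in\{0,1,2,\dots,\infty\}$, $$\operatorname{im} Sh_V=\mathcal E_{\mathrm{id}}(F,V)^k .$$ Let $W\subset V$ be open and connected, such that $W\cap\Sigma$ is closed (and hence open and closed) in $V\cap\Sigma$. Then, for the same $k$, $$\operatorname{im} Sh_W=\mathcal E_{\mathrm{id}}(F,W)^k .$$ -/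

import Mathlib

open scoped Manifold ContDiff Topology

noncomputable section

namespace ShiftMap

/-- The expression of a map `g : N → N'` in the charts `φ` of `N` and `ψ` of `N'`. -/
def chartRep
    {E : Type*} [NormedAddCommGroup E] [NormedSpace ℝ E] {H : Type*} [TopologicalSpace H]
    (I : ModelWithCorners ℝ E H) {N : Type*} [TopologicalSpace N]
    {E' : Type*} [NormedAddCommGroup E'] [NormedSpace ℝ E'] {H' : Type*} [TopologicalSpace H']
    (J : ModelWithCorners ℝ E' H') {N' : Type*} [TopologicalSpace N']
    (φ : OpenPartialHomeomorph N H) (ψ : OpenPartialHomeomorph N' H') (g : N → N') : E → E' :=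
  fun u => ψ.extend J (g ((φ.extend I).symm u))

/-- The basic set `𝒩ˡ(f; φ, ψ, K, ε)`: the smooth maps `g` carrying `K` into the domain of the
chart `ψ` and such that, in the charts `φ` and `ψ`, all derivatives of order at most `l` of `g`
and `f` are `ε`-close at the points of `K`. Derivatives are taken within `range I`, that is,
within the model space or the model half-space. -/
def weakBasicSet
    {E : Type*} [NormedAddCommGroup E] [NormedSpace ℝ E] {H : Type*} [TopologicalSpace H]
    (I : ModelWithCorners ℝ E H) {N : Type*} [TopologicalSpace N] [ChartedSpace H N]
    {E' : Type*} [NormedAddCommGroup E'] [NormedSpace ℝ E'] {H' : Type*} [TopologicalSpace H']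
    (J : ModelWithCorners ℝ E' H') {N' : Type*} [TopologicalSpace N'] [ChartedSpace H' N']
    (l : ℕ) (f : C^∞⟮I, N; J, N'⟯)
    (φ : OpenPartialHomeomorph N H) (ψ : OpenPartialHomeomorph N' H') (K : Set N) (ε : ℝ) :
    Set C^∞⟮I, N; J, N'⟯ :=
  {g | ∀ x ∈ K, g x ∈ ψ.source ∧ ∀ r ≤ l,
    ‖iteratedFDerivWithin ℝ r (chartRep I J φ ψ g) (Set.range I) (φ.extend I x) -
      iteratedFDerivWithin ℝ r (chartRep I J φ ψ f) (Set.range I) (φ.extend I x)‖ < ε}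

/-- The weak (compact-open) `C^k` topology on the set of smooth maps `N → N'`, generated by the
sets `𝒩ˡ(f; φ, ψ, K, ε)` with `l` finite, `l ≤ k`, where `φ`, `ψ` are smooth charts, `K` is a
compact subset of the domain of `φ`, `f` maps `K` into the domain of `ψ`, and `ε > 0`. For `k = ∞`
this is the topology generated by the weak `C^l` topologies for all finite `l`. -/
@[reducible] def weakTopology
    {E : Type*} [NormedAddCommGroup E] [NormedSpace ℝ E] {H : Type*} [TopologicalSpace H]
    (I : ModelWithCorners ℝ E H) (N : Type*) [TopologicalSpace N] [ChartedSpace H N]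
    {E' : Type*} [NormedAddCommGroup E'] [NormedSpace ℝ E'] {H' : Type*} [TopologicalSpace H']
    (J : ModelWithCorners ℝ E' H') (N' : Type*) [TopologicalSpace N'] [ChartedSpace H' N']
    (k : ℕ∞) : TopologicalSpace C^∞⟮I, N; J, N'⟯ :=
  TopologicalSpace.generateFrom
    {S | ∃ (l : ℕ) (f : C^∞⟮I, N; J, N'⟯) (φ : OpenPartialHomeomorph N H)
        (ψ : OpenPartialHomeomorph N' H') (K : Set N) (ε : ℝ),
      (l : ℕ∞) ≤ k ∧ φ ∈ IsManifold.maximalAtlas I ∞ N ∧ ψ ∈ IsManifold.maximalAtlas J ∞ N' ∧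
      IsCompact K ∧ K ⊆ φ.source ∧ Set.MapsTo f K ψ.source ∧ 0 < ε ∧
      S = weakBasicSet I J l f φ ψ K ε}

section Flow

variable {E : Type*} [NormedAddCommGroup E] [NormedSpace ℝ E] {H : Type*} [TopologicalSpace H]
  (I : ModelWithCorners ℝ E H) {M : Type*} [TopologicalSpace M] [ChartedSpace H M]

/-- `Φ`, with domain `D ⊆ M × ℝ`, is the smooth local flow of the vector field `F`: `D` is an open
neighbourhood of `M × 0`, `Φ` is smooth on `D`, and for every `x` the curve `t ↦ Φ x t`, defined on
`{t | (x, t) ∈ D}`, is the maximal integral curve of `F` starting at `x`. A global flow is the case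
`D = Set.univ`. Integral curves through every point, including boundary points, are two-sided here
(`D` is open), so such an `F` is automatically tangent to the boundary of `M`. -/
structure IsLocalFlow (F : (x : M) → TangentSpace I x) (D : Set (M × ℝ)) (Φ : M → ℝ → M) :
    Prop where
  isOpen_domain : IsOpen D
  zero_mem : ∀ x : M, (x, (0 : ℝ)) ∈ D
  ordConnected : ∀ x : M, {t : ℝ | (x, t) ∈ D}.OrdConnected
  contMDiffOn : ContMDiffOn (I.prod 𝓘(ℝ, ℝ)) I ∞ (fun p : M × ℝ => Φ p.1 p.2) D
  map_zero : ∀ x : M, Φ x 0 = x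
  isMIntegralCurveOn : ∀ x : M, IsMIntegralCurveOn (I := I) (Φ x) F {t : ℝ | (x, t) ∈ D}
  maximal : ∀ (x : M) (γ : ℝ → M) (T : Set ℝ), IsOpen T → T.OrdConnected → (0 : ℝ) ∈ T →
    γ 0 = x → IsMIntegralCurveOn (I := I) γ F T → ∀ t ∈ T, (x, t) ∈ D ∧ γ t = Φ x t

/-- The set of singular points (zeros) of the vector field `F`. -/
def singularSet (F : (x : M) → TangentSpace I x) : Set M := {x | F x = 0}

/-- The orbit of the point `x` under the local flow `Φ` with domain `D`. -/
def orbit (D : Set (M × ℝ)) (Φ : M → ℝ → M) (x : M) : Set M := {y | ∃ t : ℝ, (x, t) ∈ D ∧ Φ x t = y}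

/-- The inclusion `i_V : V ⊆ M` of an open subset, as a smooth map. -/
def inclusion (V : TopologicalSpace.Opens M) : C^∞⟮I, V; I, M⟯ :=
  ⟨fun x => (x : M), contMDiff_subtype_val⟩

/-- The image `im Sh_V` of the shift map: all maps `x ↦ Φ(x, α(x))`, where `α : V → ℝ` is a smooth
function whose graph lies in the domain `D` of the flow. -/
def shiftImage (D : Set (M × ℝ)) (Φ : M → ℝ → M) (V : TopologicalSpace.Opens M) :
    Set C^∞⟮I, V; I, M⟯ :=
  {h | ∃ α : C^∞⟮I, V; 𝓘(ℝ, ℝ), ℝ⟯,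
    (∀ x : V, ((x : M), α x) ∈ D) ∧ ∀ x : V, h x = Φ (x : M) (α x)}

/-- The set `E(F, V)`: the smooth maps `h : V → M` such that `h (o ∩ V) ⊆ o` for every orbit `o`,
and `h` is a local diffeomorphism at every singular point of `F` in `V`. -/
def endo (F : (x : M) → TangentSpace I x) (D : Set (M × ℝ)) (Φ : M → ℝ → M)
    (V : TopologicalSpace.Opens M) : Set C^∞⟮I, V; I, M⟯ :=
  {h | (∀ (x : M) (y : V), (y : M) ∈ orbit D Φ x → h y ∈ orbit D Φ x) ∧
    ∀ z : V, (z : M) ∈ singularSet I F → IsLocalDiffeomorphAt I I ∞ h z}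

/-- The set `E_id(F, V)^k`: the path component of the inclusion `i_V` in `E(F, V)` with respect to
the weak `C^k` topology. -/
def endoId (F : (x : M) → TangentSpace I x) (D : Set (M × ℝ)) (Φ : M → ℝ → M)
    (V : TopologicalSpace.Opens M) (k : ℕ∞) : Set C^∞⟮I, V; I, M⟯ :=
  letI : TopologicalSpace C^∞⟮I, V; I, M⟯ := weakTopology I V I M k
  pathComponentIn (endo I F D Φ V) (inclusion I V)

end Flow

end ShiftMap

end

/-! Write Σ for the singular set. Since W ∩ Σ is closed in V (Σ itself is closed), there is a smooth
cutoff χ : V → [0,1] which vanishes near V ∖ W and equals 1 near W ∩ Σ (`exists_cutoff`). It carries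
data from W to V without changing them near W ∩ Σ, the only place where a shift function is hard to
control.

Shifts lie in the path component: Φ(x, α(x)) is joined to the inclusion by Φ(x, tα(x)). Every stage
preserves orbits. It is also a local diffeomorphism at a point of W ∩ Σ, because near that point it
agrees with the shift of V by χtα, and shifts of V lie in E(F, V) by hypothesis
(`mem_endo_of_shift`, `shiftImage_subset_endoId`).

Conversely, let p be a path in E(F, W) from the inclusion to h. For x outside Σ the curve t ↦ p_t(x)
stays in the orbit of x and lifts uniquely to flow times α_t(x) with α_0 = 0. Flow boxes show that
α_t is smooth off Σ (`IsLocalFlow.exists_family_lift`); nothing is claimed at Σ. Put q_t(x) = Φ(x,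
χ(x)α_t(x)) on W and q_t(x) = x elsewhere. Near W ∩ Σ this is p_t, and off Σ it is locally a fixed
smooth function of x and p_t(x). Hence q is a path in E(F, V), and the hypothesis gives q_1(x) =
Φ(x, α'(x)) with α' smooth on V. Then α' + (1 − χ)α_1 is smooth on W, since 1 − χ vanishes near Σ,
and it is a shift function for h (`endoId_subset_shiftImage`).

Continuity in the weak C^k topology is handled through joint continuity, in parameter and point, of
the derivatives in charts (`continuous_weakTopology`, `mfamilyAt_of_continuous`). -/

namespace ShiftMap

open Set Filter

/-! ### Continuous families of C^l maps between normed spaces -/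

/-- A family `H t` of maps, depending on a parameter `t`, is a continuous family of `C^l` maps at
`(t₀, u₀)` within `S` if all derivatives of `H t` of order at most `l` depend continuously on both
variables. -/
def FamilyAt {T : Type*} [TopologicalSpace T] {E : Type*} [NormedAddCommGroup E] [NormedSpace ℝ E]
    {E' : Type*} [NormedAddCommGroup E'] [NormedSpace ℝ E'] (l : ℕ) (S : Set E) (H : T → E → E')
    (t₀ : T) (u₀ : E) : Prop :=
  (∀ᶠ p in 𝓝[univ ×ˢ S] (t₀, u₀), ContDiffWithinAt ℝ l (H p.1) S p.2) ∧
    ∀ r ≤ l, ContinuousWithinAt (fun p : T × E => iteratedFDerivWithin ℝ r (H p.1) S p.2)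
      (univ ×ˢ S) (t₀, u₀)

section Euclidean

variable {T : Type*} [TopologicalSpace T] {E : Type*} [NormedAddCommGroup E] [NormedSpace ℝ E]
  {E' : Type*} [NormedAddCommGroup E'] [NormedSpace ℝ E']
  {E'' : Type*} [NormedAddCommGroup E''] [NormedSpace ℝ E'']
  {l : ℕ} {S : Set E} {S' : Set E'} {H H' : T → E → E'} {t₀ : T} {u₀ : E}

lemma FamilyAt.continuousWithinAt (h : FamilyAt l S H t₀ u₀) :
    ContinuousWithinAt (fun p : T × E => H p.1 p.2) (univ ×ˢ S) (t₀, u₀) := by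
  have h0 := h.2 0 (Nat.zero_le _)
  have := (continuousMultilinearCurryFin0 ℝ E E').continuous.continuousAt.comp_continuousWithinAt h0
  refine this.congr (fun p _ => ?_) ?_ <;> simp [iteratedFDerivWithin_zero_eq_comp]

lemma FamilyAt.const {f : E → E'} (hf : ContDiffWithinAt ℝ l f S u₀) (hS : UniqueDiffOn ℝ S)
    (hu : u₀ ∈ S) : FamilyAt l S (fun _ : T => f) t₀ u₀ := by
  have hsnd : Tendsto (Prod.snd : T × E → E) (𝓝[univ ×ˢ S] (t₀, u₀)) (𝓝[S] u₀) := by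
    refine tendsto_nhdsWithin_iff.2 ⟨?_, ?_⟩
    · exact (continuous_snd.tendsto' _ _ rfl).mono_left nhdsWithin_le_nhds
    · filter_upwards [self_mem_nhdsWithin] with p hp using hp.2
  refine ⟨?_, fun r hr => ?_⟩
  · have := hf.eventually (by simp)
    rw [insert_eq_of_mem hu] at this
    exact hsnd.eventually this
  · have := hf.continuousWithinAt_iteratedFDerivWithin (k := r) hS (by exact_mod_cast hr) hu
    exact this.tendsto.comp hsnd

/-- Agreement near `(t₀, u₀)` in the product gives, at each nearby `p`, agreement of the slices near
`p.2`, hence equality of all their derivatives there. -/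
lemma FamilyAt.congr (h : FamilyAt l S H t₀ u₀)
    (he : ∀ᶠ p in 𝓝[univ ×ˢ S] (t₀, u₀), H p.1 p.2 = H' p.1 p.2) (hu : u₀ ∈ S) :
    FamilyAt l S H' t₀ u₀ := by
  have hloc : ∀ᶠ p in 𝓝[univ ×ˢ S] (t₀, u₀), H' p.1 =ᶠ[𝓝[S] p.2] H p.1 := by
    filter_upwards [eventually_eventually_nhdsWithin.2 he] with p hp
    have : Tendsto (fun u => (p.1, u)) (𝓝[S] p.2) (𝓝[univ ×ˢ S] p) := by
      refine tendsto_nhdsWithin_iff.2 ⟨?_, ?_⟩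
      · exact ((Continuous.prodMk_right p.1).tendsto' _ _ rfl).mono_left nhdsWithin_le_nhds
      · filter_upwards [self_mem_nhdsWithin] with u hu using ⟨mem_univ _, hu⟩
    exact (this.eventually hp).mono fun u hu => hu.symm
  have hself : (t₀, u₀) ∈ (univ : Set T) ×ˢ S := ⟨mem_univ _, hu⟩
  refine ⟨?_, fun r hr => ?_⟩
  · filter_upwards [h.1, hloc, self_mem_nhdsWithin] with p h1 h2 h3
    exact h1.congr_of_eventuallyEq h2 (h2.self_of_nhdsWithin h3.2)
  · refine (h.2 r hr).congr_of_eventuallyEq ?_ ?_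
    · filter_upwards [hloc, self_mem_nhdsWithin] with p h2 h3
      exact h2.iteratedFDerivWithin_eq (h2.self_of_nhdsWithin h3.2) r
    · have h2 := hloc.self_of_nhdsWithin hself
      exact h2.iteratedFDerivWithin_eq (h2.self_of_nhdsWithin hu) r

lemma FamilyAt.prodMk {G : T → E → E''} (hH : FamilyAt l S H t₀ u₀) (hG : FamilyAt l S G t₀ u₀)
    (hS : UniqueDiffOn ℝ S) (hu : u₀ ∈ S) :
    FamilyAt l S (fun t u => (H t u, G t u)) t₀ u₀ := by
  refine ⟨?_, fun r hr => ?_⟩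
  · filter_upwards [hH.1, hG.1] with p h1 h2 using h1.prodMk h2
  · have key : ∀ p : T × E, p ∈ (univ : Set T) ×ˢ S → ContDiffWithinAt ℝ l (H p.1) S p.2 →
        ContDiffWithinAt ℝ l (G p.1) S p.2 →
        iteratedFDerivWithin ℝ r (fun u => (H p.1 u, G p.1 u)) S p.2 =
          ContinuousMultilinearMap.prodL ℝ (fun _ : Fin r => E) E' E''
          (iteratedFDerivWithin ℝ r (H p.1) S p.2, iteratedFDerivWithin ℝ r (G p.1) S p.2) :=
      fun p hp h1 h2 => iteratedFDerivWithin_prodMk h1 h2 hS hp.2 (by exact_mod_cast hr)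
    have hc := (ContinuousMultilinearMap.prodL ℝ (fun _ : Fin r => E) E' E'').continuous.continuousAt
      |>.comp_continuousWithinAt ((hH.2 r hr).prodMk (hG.2 r hr))
    have hself : (t₀, u₀) ∈ (univ : Set T) ×ˢ S := ⟨mem_univ _, hu⟩
    refine hc.congr_of_eventuallyEq ?_ ?_
    · filter_upwards [hH.1, hG.1, self_mem_nhdsWithin] with p h1 h2 hp using key p hp h1 h2
    · exact key _ hself (hH.1.self_of_nhdsWithin hself) (hG.1.self_of_nhdsWithin hself)

/-- Faà di Bruno's formula writes each derivative of the composite as a finite sum of terms linear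
in a derivative of `G` and multilinear in derivatives of `H`, all jointly continuous. -/
lemma FamilyAt.comp {G : T → E' → E''} (hG : FamilyAt l S' G t₀ (H t₀ u₀))
    (hH : FamilyAt l S H t₀ u₀) (hS : UniqueDiffOn ℝ S) (hS' : UniqueDiffOn ℝ S') (hu : u₀ ∈ S)
    (hmaps : ∀ t, MapsTo (H t) S S') :
    FamilyAt l S (fun t u => G t (H t u)) t₀ u₀ := by
  have hself : (t₀, u₀) ∈ (univ : Set T) ×ˢ S := ⟨mem_univ _, hu⟩
  have htend : Tendsto (fun p : T × E => (p.1, H p.1 p.2)) (𝓝[univ ×ˢ S] (t₀, u₀))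
      (𝓝[univ ×ˢ S'] (t₀, H t₀ u₀)) := by
    refine tendsto_nhdsWithin_iff.2 ⟨?_, ?_⟩
    · exact (continuousWithinAt_fst.prodMk hH.continuousWithinAt).tendsto
    · filter_upwards [self_mem_nhdsWithin] with p hp using ⟨mem_univ _, hmaps _ hp.2⟩
  refine ⟨?_, fun r hr => ?_⟩
  · filter_upwards [hH.1, htend.eventually hG.1] with p h1 h2
    exact h2.comp p.2 h1 (hmaps _)
  · have key : ∀ p : T × E, p ∈ (univ : Set T) ×ˢ S → ContDiffWithinAt ℝ l (H p.1) S p.2 →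
        ContDiffWithinAt ℝ l (G p.1) S' (H p.1 p.2) →
        iteratedFDerivWithin ℝ r (fun u => G p.1 (H p.1 u)) S p.2 =
          ∑ c : OrderedFinpartition r, c.compAlongOrderedFinpartitionL ℝ E E' E''
            (iteratedFDerivWithin ℝ c.length (G p.1) S' (H p.1 p.2))
            (fun m => iteratedFDerivWithin ℝ (c.partSize m) (H p.1) S p.2) :=
      fun p hp h1 h2 => iteratedFDerivWithin_comp h2 h1 hS' hS hp.2 (hmaps _)
        (by exact_mod_cast hr)
    have hc : ContinuousWithinAt (fun p : T × E =>
        ∑ c : OrderedFinpartition r, c.compAlongOrderedFinpartitionL ℝ E E' E''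
            (iteratedFDerivWithin ℝ c.length (G p.1) S' (H p.1 p.2))
            (fun m => iteratedFDerivWithin ℝ (c.partSize m) (H p.1) S p.2))
        (univ ×ˢ S) (t₀, u₀) := by
      refine tendsto_finsetSum _ fun c _ => ?_
      have hc1 : ContinuousWithinAt (fun p : T × E =>
          iteratedFDerivWithin ℝ c.length (G p.1) S' (H p.1 p.2)) (univ ×ˢ S) (t₀, u₀) :=
        (hG.2 _ (c.length_le.trans hr)).tendsto.comp htend
      have hc2 : ContinuousWithinAt (fun p : T × E => fun m =>
          iteratedFDerivWithin ℝ (c.partSize m) (H p.1) S p.2) (univ ×ˢ S) (t₀, u₀) :=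
        tendsto_pi_nhds.2 fun m => hH.2 _ ((c.partSize_le m).trans hr)
      have hev : Continuous fun q : (E' [×c.length]→L[ℝ] E'') ×
          (∀ m : Fin c.length, E [×c.partSize m]→L[ℝ] E') =>
          c.compAlongOrderedFinpartitionL ℝ E E' E'' q.1 q.2 :=
        (c.compAlongOrderedFinpartitionL ℝ E E' E'').continuous_uncurry_of_multilinear
      exact hev.continuousAt.comp_continuousWithinAt (hc1.prodMk hc2)
    refine hc.congr_of_eventuallyEq ?_ ?_
    · filter_upwards [hH.1, htend.eventually hG.1, self_mem_nhdsWithin] with p h1 h2 hp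
        using key p hp h1 h2
    · exact key _ hself (hH.1.self_of_nhdsWithin hself)
        (hG.1.self_of_nhdsWithin ⟨mem_univ _, hmaps _ hu⟩)

lemma FamilyAt.smul_const {f : E → E'} {c : T → ℝ} (hc : ContinuousAt c t₀)
    (hf : ContDiffWithinAt ℝ l f S u₀) (hS : UniqueDiffOn ℝ S) (hu : u₀ ∈ S) :
    FamilyAt l S (fun t u => c t • f u) t₀ u₀ := by
  have h0 : FamilyAt l S (fun _ : T => f) t₀ u₀ := .const hf hS hu
  have hself : (t₀, u₀) ∈ (univ : Set T) ×ˢ S := ⟨mem_univ _, hu⟩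
  refine ⟨?_, fun r hr => ?_⟩
  · filter_upwards [h0.1] with p hp using contDiffWithinAt_const.smul hp
  · have hc' : ContinuousWithinAt (fun p : T × E => c p.1) (univ ×ˢ S) (t₀, u₀) :=
      (hc.comp_of_eq continuousAt_fst rfl).continuousWithinAt
    have key : ∀ p : T × E, p ∈ (univ : Set T) ×ˢ S → ContDiffWithinAt ℝ l f S p.2 →
        iteratedFDerivWithin ℝ r (fun u => c p.1 • f u) S p.2 =
          c p.1 • iteratedFDerivWithin ℝ r f S p.2 := fun p hp h1 =>
      iteratedFDerivWithin_const_smul_apply (h1.of_le (by exact_mod_cast hr)) hS hp.2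
    refine (hc'.smul (h0.2 r hr)).congr_of_eventuallyEq ?_ ?_
    · filter_upwards [h0.1, self_mem_nhdsWithin] with p h1 hp using key p hp h1
    · exact key _ hself hf

end Euclidean

/-! ### Limits through extended charts -/

section ExtendedCharts

variable {T : Type*} [TopologicalSpace T]
  {E : Type*} [NormedAddCommGroup E] [NormedSpace ℝ E] {H : Type*} [TopologicalSpace H]
  {I : ModelWithCorners ℝ E H} {N : Type*} [TopologicalSpace N]

lemma tendsto_extend_symm {φ : OpenPartialHomeomorph N H} {x₀ : N} (hx : x₀ ∈ φ.source) :
    Tendsto (φ.extend I).symm (𝓝[range I] (φ.extend I x₀)) (𝓝 x₀) := by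
  have := (φ.continuousAt_extend_symm (I := I) hx).tendsto
  rw [φ.extend_left_inv hx] at this
  exact this.mono_left nhdsWithin_le_nhds

lemma tendsto_prod_extend_symm {φ : OpenPartialHomeomorph N H} {x₀ : N} (hx : x₀ ∈ φ.source)
    (t₀ : T) :
    Tendsto (fun p : T × E => (p.1, (φ.extend I).symm p.2))
      (𝓝[univ ×ˢ range I] (t₀, φ.extend I x₀)) (𝓝 (t₀, x₀)) := by
  rw [nhdsWithin_prod_eq, nhdsWithin_univ, nhds_prod_eq]
  exact tendsto_id.prodMap (tendsto_extend_symm hx)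

lemma extend_mem_range (φ : OpenPartialHomeomorph N H) (x : N) : φ.extend I x ∈ range I :=
  ⟨φ x, rfl⟩

lemma tendsto_prod_extend {φ : OpenPartialHomeomorph N H} {x₀ : N} (hx : x₀ ∈ φ.source)
    (t₀ : T) :
    Tendsto (fun p : T × N => (p.1, φ.extend I p.2)) (𝓝 (t₀, x₀))
      (𝓝[univ ×ˢ range I] (t₀, φ.extend I x₀)) := by
  refine tendsto_nhdsWithin_iff.2 ⟨?_, Eventually.of_forall fun p => ⟨mem_univ _,
    extend_mem_range φ _⟩⟩
  rw [nhds_prod_eq, nhds_prod_eq]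
  exact tendsto_id.prodMap (φ.continuousAt_extend hx)

end ExtendedCharts

/-! ### Families of maps between manifolds and the weak topology -/

section ManifoldFamilies

variable {T : Type*} [TopologicalSpace T]
  {E : Type*} [NormedAddCommGroup E] [NormedSpace ℝ E] {H : Type*} [TopologicalSpace H]
  {I : ModelWithCorners ℝ E H} {N : Type*} [TopologicalSpace N] [ChartedSpace H N]
  {E' : Type*} [NormedAddCommGroup E'] [NormedSpace ℝ E'] {H' : Type*} [TopologicalSpace H']
  {J : ModelWithCorners ℝ E' H'} {N' : Type*} [TopologicalSpace N'] [ChartedSpace H' N']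
  {E₁ : Type*} [NormedAddCommGroup E₁] [NormedSpace ℝ E₁] {H₁ : Type*} [TopologicalSpace H₁]
  {I₁ : ModelWithCorners ℝ E₁ H₁} {N₁ : Type*} [TopologicalSpace N₁] [ChartedSpace H₁ N₁]
  {E₂ : Type*} [NormedAddCommGroup E₂] [NormedSpace ℝ E₂] {H₂ : Type*} [TopologicalSpace H₂]
  {K : ModelWithCorners ℝ E₂ H₂} {N₂ : Type*} [TopologicalSpace N₂] [ChartedSpace H₂ N₂]

/-- `g t` is, near `(t₀, x₀)` and in the charts `φ` and `ψ`, a continuous family of `C^l` maps. -/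
def MFamilyAt (I : ModelWithCorners ℝ E H) (J : ModelWithCorners ℝ E' H') (l : ℕ)
    (φ : OpenPartialHomeomorph N H) (ψ : OpenPartialHomeomorph N' H')
    (g : T → N → N') (t₀ : T) (x₀ : N) : Prop :=
  ContinuousAt (fun p : T × N => g p.1 p.2) (t₀, x₀) ∧
    FamilyAt l (range I) (fun t => chartRep I J φ ψ (g t)) t₀ (φ.extend I x₀)

lemma contMDiffWithinAt_extend_symm {φ : OpenPartialHomeomorph N H}
    (hφ : φ ∈ IsManifold.maximalAtlas I ∞ N) {x : N} (hx : x ∈ φ.source) :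
    ContMDiffWithinAt 𝓘(ℝ, E) I ∞ (φ.extend I).symm (range I) (φ.extend I x) := by
  refine (contMDiffOn_extend_symm hφ _ ⟨φ x, φ.map_source hx, rfl⟩).mono_of_mem_nhdsWithin ?_
  rw [← φ.extend_target']
  exact φ.extend_target_mem_nhdsWithin hx

/-- Composing a continuous family of `C^l` maps with smooth maps, on either side, gives a continuous
family of `C^l` maps, in any charts. -/
lemma MFamilyAt.comp {l : ℕ} {φ : OpenPartialHomeomorph N H} {ψ : OpenPartialHomeomorph N' H'}
    {φ₁ : OpenPartialHomeomorph N₁ H₁} {ψ₂ : OpenPartialHomeomorph N₂ H₂}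
    {g : T → N → N'} {t₀ : T} {x₀ : N₁} {j : N₁ → N} {Q : N₁ × N' → N₂}
    (hφ : φ ∈ IsManifold.maximalAtlas I ∞ N) (hψ : ψ ∈ IsManifold.maximalAtlas J ∞ N')
    (hφ₁ : φ₁ ∈ IsManifold.maximalAtlas I₁ ∞ N₁) (hψ₂ : ψ₂ ∈ IsManifold.maximalAtlas K ∞ N₂)
    (hg : MFamilyAt I J l φ ψ g t₀ (j x₀)) (hj : ContMDiffAt I₁ I ∞ j x₀)
    (hQ : ContMDiffAt (I₁.prod J) K ∞ Q (x₀, g t₀ (j x₀)))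
    (hx : j x₀ ∈ φ.source) (hy : g t₀ (j x₀) ∈ ψ.source) (hx₁ : x₀ ∈ φ₁.source)
    (hz : Q (x₀, g t₀ (j x₀)) ∈ ψ₂.source) :
    MFamilyAt I₁ K l φ₁ ψ₂ (fun t x => Q (x, g t (j x))) t₀ x₀ := by
  have hl : ((l : ℕ) : ℕ∞ω) ≤ ∞ := by exact_mod_cast le_top
  have hjc : ContinuousAt (fun p : T × N₁ => j p.2) (t₀, x₀) :=
    hj.continuousAt.comp_of_eq continuousAt_snd rfl
  have hgc : ContinuousAt (fun p : T × N₁ => g p.1 (j p.2)) (t₀, x₀) :=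
    hg.1.comp_of_eq (f := fun p : T × N₁ => (p.1, j p.2)) (continuousAt_fst.prodMk hjc) rfl
  refine ⟨hQ.continuousAt.comp_of_eq (f := fun p : T × N₁ => (p.2, g p.1 (j p.2)))
    (continuousAt_snd.prodMk hgc) rfl, ?_⟩
  set u₀ := φ₁.extend I₁ x₀ with hu₀
  have hu : u₀ ∈ range I₁ := extend_mem_range φ₁ x₀
  have hS₁ : UniqueDiffOn ℝ (range I₁) := I₁.uniqueDiffOn
  have hsymm : (φ₁.extend I₁).symm u₀ = x₀ := φ₁.extend_left_inv hx₁
  have hA : FamilyAt l (range I₁) (fun _ : T => chartRep I₁ I φ₁ φ j) t₀ u₀ :=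
    .const (((contMDiffAt_iff_of_mem_maximalAtlas hφ₁ hφ hx₁ hx).1 hj).2.of_le hl) hS₁ hu
  have hAu : chartRep I₁ I φ₁ φ j u₀ = φ.extend I (j x₀) := by
    change φ.extend I (j ((φ₁.extend I₁).symm u₀)) = _
    rw [hsymm]
  have hB : FamilyAt l (range I₁)
      (fun (t : T) u => chartRep I J φ ψ (g t) (chartRep I₁ I φ₁ φ j u)) t₀ u₀ :=
    FamilyAt.comp (G := fun (t : T) => chartRep I J φ ψ (g t))
      (H := fun _ : T => chartRep I₁ I φ₁ φ j) (hAu.symm ▸ hg.2) hA hS₁ I.uniqueDiffOn hu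
      fun _ _ _ => extend_mem_range φ _
  -- The identity component keeps the base point available, since `Q` depends on it as well as on
  -- the value of `g t`.
  have hC := (FamilyAt.const (T := T) (t₀ := t₀) (l := l) contDiffWithinAt_id hS₁ hu).prodMk
    hB hS₁ hu
  have hBu : chartRep I J φ ψ (g t₀) (chartRep I₁ I φ₁ φ j u₀) =
      ψ.extend J (g t₀ (j x₀)) := by
    rw [hAu]
    change ψ.extend J (g t₀ ((φ.extend I).symm (φ.extend I (j x₀)))) = _
    rw [φ.extend_left_inv hx]
  have hQ' : ContDiffWithinAt ℝ l
      (fun p : E₁ × E' => ψ₂.extend K (Q ((φ₁.extend I₁).symm p.1, (ψ.extend J).symm p.2)))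
      (range I₁ ×ˢ range J) (u₀, ψ.extend J (g t₀ (j x₀))) := by
    have h1 : ContMDiffWithinAt 𝓘(ℝ, E₁ × E') I₁ ∞
        (fun p : E₁ × E' => (φ₁.extend I₁).symm p.1) (range I₁ ×ˢ range J)
        (u₀, ψ.extend J (g t₀ (j x₀))) :=
      ContMDiffWithinAt.comp (f := Prod.fst) (u₀, ψ.extend J (g t₀ (j x₀)))
        (contMDiffWithinAt_extend_symm hφ₁ hx₁) contDiff_fst.contDiffWithinAt.contMDiffWithinAt
        (fun _ hp => hp.1 : MapsTo Prod.fst (range I₁ ×ˢ range J) (range I₁))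
    have h2 : ContMDiffWithinAt 𝓘(ℝ, E₁ × E') J ∞
        (fun p : E₁ × E' => (ψ.extend J).symm p.2) (range I₁ ×ˢ range J)
        (u₀, ψ.extend J (g t₀ (j x₀))) :=
      ContMDiffWithinAt.comp (f := Prod.snd) (u₀, ψ.extend J (g t₀ (j x₀)))
        (contMDiffWithinAt_extend_symm hψ hy) contDiff_snd.contDiffWithinAt.contMDiffWithinAt
        (fun _ hp => hp.2 : MapsTo Prod.snd (range I₁ ×ˢ range J) (range J))
    have h3 : ContMDiffAt K 𝓘(ℝ, E₂) ∞ (ψ₂.extend K) (Q (x₀, g t₀ (j x₀))) :=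
      ψ₂.contMDiffAt_extend hψ₂ hz
    have hpt : ((φ₁.extend I₁).symm u₀, (ψ.extend J).symm (ψ.extend J (g t₀ (j x₀)))) =
        (x₀, g t₀ (j x₀)) := by rw [hsymm, ψ.extend_left_inv hy]
    have h4 := (h3.comp (x₀, g t₀ (j x₀)) hQ).comp_contMDiffWithinAt_of_eq
      (h1.prodMk h2) hpt
    exact (contMDiffWithinAt_iff_contDiffWithinAt.1 h4).of_le hl
  have hD := FamilyAt.comp (t₀ := t₀) (u₀ := u₀) (H := fun (t : T) u => (id u,
      chartRep I J φ ψ (g t) (chartRep I₁ I φ₁ φ j u))) (S' := range I₁ ×ˢ range J)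
    (G := fun (_ : T) (p : E₁ × E') =>
      ψ₂.extend K (Q ((φ₁.extend I₁).symm p.1, (ψ.extend J).symm p.2)))
    (by
      rw [hBu]
      exact .const hQ' (hS₁.prod J.uniqueDiffOn) ⟨hu, extend_mem_range ψ _⟩) hC hS₁
    (hS₁.prod J.uniqueDiffOn) hu fun t u hu => ⟨hu, extend_mem_range ψ _⟩
  refine hD.congr ?_ hu
  -- The factorization inserts a chart followed by its inverse, which cancel only inside the chart
  -- domains; this is why the two families agree only locally.
  have hev : ∀ᶠ p : T × N₁ in 𝓝 (t₀, x₀), j p.2 ∈ φ.source ∧ g p.1 (j p.2) ∈ ψ.source :=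
    (hjc.eventually_mem (φ.open_source.mem_nhds hx)).and
      (hgc.eventually_mem (ψ.open_source.mem_nhds hy))
  filter_upwards [(tendsto_prod_extend_symm hx₁ t₀).eventually hev] with p hp
  simp only [chartRep, id]
  rw [φ.extend_left_inv hp.1, ψ.extend_left_inv hp.2]

/-- A path of smooth maps is continuous in the weak `C^k` topology if it is, in all charts, a
continuous family of `C^l` maps for every finite `l ≤ k`. -/
lemma continuous_weakTopology {k : ℕ∞} {p : T → C^∞⟮I, N; J, N'⟯}
    (h : ∀ l : ℕ, (l : ℕ∞) ≤ k → ∀ t₀ x₀, ∀ φ ∈ IsManifold.maximalAtlas I ∞ N,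
      ∀ ψ ∈ IsManifold.maximalAtlas J ∞ N', x₀ ∈ φ.source → p t₀ x₀ ∈ ψ.source →
        MFamilyAt I J l φ ψ (fun t => p t) t₀ x₀) :
    letI := weakTopology I N J N' k
    Continuous p := by
  let := weakTopology I N J N' k
  refine continuous_generateFrom_iff.2 ?_
  rintro _ ⟨l, f, φ, ψ, K, ε, hlk, hφ, hψ, hK, hKφ, hf, hε, rfl⟩
  refine isOpen_iff_mem_nhds.2 fun t₀ ht₀ => ?_
  -- By compactness of `K`, it suffices to obtain the estimate near each single point `(t₀, x)`.
  refine hK.eventually_forall_of_forall_eventually (P := fun t x => p t x ∈ ψ.source ∧ ∀ r ≤ l,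
    ‖iteratedFDerivWithin ℝ r (chartRep I J φ ψ (p t)) (range I) (φ.extend I x) -
      iteratedFDerivWithin ℝ r (chartRep I J φ ψ f) (range I) (φ.extend I x)‖ < ε) ?_
  intro x hx
  have hxφ := hKφ hx
  obtain ⟨h1, h2⟩ := h l hlk t₀ x φ hφ ψ hψ hxφ (ht₀ x hx).1
  have hfx : ContDiffWithinAt ℝ l (chartRep I J φ ψ f) (range I) (φ.extend I x) :=
    ((contMDiffAt_iff_of_mem_maximalAtlas hφ hψ hxφ (hf hx)).1
      (f.contMDiff x)).2.of_le (by exact_mod_cast le_top)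
  have h3 := FamilyAt.const (T := T) (t₀ := t₀) hfx I.uniqueDiffOn (extend_mem_range φ x)
  refine (h1.eventually_mem (ψ.open_source.mem_nhds (ht₀ x hx).1)).and ?_
  have h4 : ∀ r ∈ Finset.range (l + 1), ∀ᶠ q : T × N in 𝓝 (t₀, x),
      ‖iteratedFDerivWithin ℝ r (chartRep I J φ ψ (p q.1)) (range I) (φ.extend I q.2) -
        iteratedFDerivWithin ℝ r (chartRep I J φ ψ f) (range I) (φ.extend I q.2)‖ < ε := by
    intro r hr
    have hr' : r ≤ l := by simpa [Nat.lt_succ_iff] using hr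
    have h5 := ((h2.2 r hr').sub (h3.2 r hr')).norm
    exact (h5.tendsto.comp (tendsto_prod_extend hxφ t₀)).eventually
      (gt_mem_nhds ((ht₀ x hx).2 r hr'))
  filter_upwards [(Finset.eventually_all _).2 h4] with q hq r hr
  exact hq r (by simpa [Nat.lt_succ_iff] using hr)

/-- A path of smooth maps which is continuous in the weak `C^k` topology is, in all charts, a
continuous family of `C^l` maps for every finite `l ≤ k`. -/
lemma mfamilyAt_of_continuous [LocallyCompactSpace N] {k : ℕ∞} {p : T → C^∞⟮I, N; J, N'⟯}
    (hp : letI := weakTopology I N J N' k; Continuous p) {l : ℕ} (hl : (l : ℕ∞) ≤ k)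
    {t₀ : T} {x₀ : N} {φ : OpenPartialHomeomorph N H} {ψ : OpenPartialHomeomorph N' H'}
    (hφ : φ ∈ IsManifold.maximalAtlas I ∞ N) (hψ : ψ ∈ IsManifold.maximalAtlas J ∞ N')
    (hx : x₀ ∈ φ.source) (hy : p t₀ x₀ ∈ ψ.source) :
    MFamilyAt I J l φ ψ (fun t => p t) t₀ x₀ := by
  have hnhds : φ.source ∩ p t₀ ⁻¹' ψ.source ∈ 𝓝 x₀ :=
    inter_mem (φ.open_source.mem_nhds hx)
      ((p t₀).contMDiff.continuous.continuousAt (ψ.open_source.mem_nhds hy))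
  -- On a compact neighbourhood inside both chart domains, the basic sets centred at `p t₀` itself
  -- are open and give uniform control for `t` near `t₀`.
  obtain ⟨K, hKx, hKsub, hK⟩ := local_compact_nhds hnhds
  have hxK : x₀ ∈ K := mem_of_mem_nhds hKx
  have hbasic : ∀ ε > 0, ∀ᶠ t in 𝓝 t₀, p t ∈ weakBasicSet I J l (p t₀) φ ψ K ε := by
    intro ε hε
    let := weakTopology I N J N' k
    have hopen : IsOpen (weakBasicSet I J l (p t₀) φ ψ K ε) :=
      TopologicalSpace.isOpen_generateFrom_of_mem ⟨l, p t₀, φ, ψ, K, ε, hl, hφ, hψ, hK,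
        fun x hx => (hKsub hx).1, fun x hx => (hKsub hx).2, hε, rfl⟩
    refine (Continuous.continuousAt hp).eventually_mem (hopen.mem_nhds ?_)
    exact fun x hx => ⟨(hKsub hx).2, fun r _ => by simpa using hε⟩
  have hsmooth : ∀ t, ∀ x ∈ K, p t x ∈ ψ.source →
      ContDiffWithinAt ℝ l (chartRep I J φ ψ (p t)) (range I) (φ.extend I x) := fun t x hx h =>
    ((contMDiffAt_iff_of_mem_maximalAtlas hφ hψ (hKsub hx).1 h).1
      ((p t).contMDiff x)).2.of_le (by exact_mod_cast le_top)
  have hK' : ∀ᶠ q : T × E in 𝓝[univ ×ˢ range I] (t₀, φ.extend I x₀),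
      (φ.extend I).symm q.2 ∈ K ∧ φ.extend I ((φ.extend I).symm q.2) = q.2 := by
    refine ((tendsto_prod_extend_symm hx t₀).snd_nhds.eventually_mem hKx).and ?_
    have : ∀ᶠ u in 𝓝[range I] φ.extend I x₀, φ.extend I ((φ.extend I).symm u) = u := by
      filter_upwards [φ.extend_target_mem_nhdsWithin hx] with u hu
      exact (φ.extend I).right_inv hu
    rw [nhdsWithin_prod_eq, nhdsWithin_univ]
    exact tendsto_snd.eventually this
  have hT : ∀ ε > 0, ∀ᶠ q : T × E in 𝓝[univ ×ˢ range I] (t₀, φ.extend I x₀),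
      p q.1 ∈ weakBasicSet I J l (p t₀) φ ψ K ε := fun ε hε => by
    have := (continuous_fst.tendsto (t₀, φ.extend I x₀)).eventually (hbasic ε hε)
    exact this.filter_mono nhdsWithin_le_nhds
  have hfam : FamilyAt l (range I) (fun t => chartRep I J φ ψ (p t)) t₀ (φ.extend I x₀) := by
    refine ⟨?_, fun r hr => ?_⟩
    · filter_upwards [hK', hT 1 one_pos] with q h1 h2
      have := hsmooth q.1 _ h1.1 (h2 _ h1.1).1
      rwa [h1.2] at this
    · have h3 := (FamilyAt.const (T := T) (t₀ := t₀) (hsmooth t₀ x₀ hxK hy) I.uniqueDiffOn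
        (extend_mem_range φ x₀)).2 r hr
      -- Half of `ε` pays for replacing `p t` by `p t₀` uniformly on `K`, the other half for moving
      -- the point in the derivative of the fixed map `p t₀`.
      refine Metric.tendsto_nhds.2 fun ε hε => ?_
      filter_upwards [hK', hT (ε / 2) (half_pos hε),
        Metric.tendsto_nhds.1 h3.tendsto (ε / 2) (half_pos hε)] with q h1 h2 h4
      have h5 := (h2 _ h1.1).2 r hr
      rw [h1.2, ← dist_eq_norm] at h5
      calc _ ≤ _ := dist_triangle _ _ _
        _ < ε / 2 + ε / 2 := add_lt_add h5 h4
        _ = ε := add_halves ε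
  refine ⟨?_, hfam⟩
  have hsrc : ∀ᶠ q : T × N in 𝓝 (t₀, x₀), p q.1 q.2 ∈ ψ.source ∧ q.2 ∈ φ.source := by
    filter_upwards [(continuous_fst.tendsto (t₀, x₀)).eventually (hbasic 1 one_pos),
      (continuous_snd.tendsto (t₀, x₀)).eventually_mem hKx] with q h1 h2
    exact ⟨(h1 _ h2).1, (hKsub h2).1⟩
  have hlim := hfam.continuousWithinAt.tendsto.comp (tendsto_prod_extend hx t₀)
  simp only [chartRep, φ.extend_left_inv hx] at hlim
  have hlim' := (ψ.continuousAt_extend_symm (I := J) hy).tendsto.comp hlim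
  rw [ψ.extend_left_inv hy] at hlim'
  refine hlim'.congr' ?_
  filter_upwards [hsrc] with q hq
  simp only [Function.comp]
  rw [φ.extend_left_inv hq.2, ψ.extend_left_inv hq.1]

end ManifoldFamilies

/-! ### A scalar implicit function theorem that allows boundary points -/

section Implicit

variable {E : Type*} [NormedAddCommGroup E] [NormedSpace ℝ E]

/-- The derivative of a continuous function defined implicitly by a scalar equation. -/
lemma hasFDerivWithinAt_of_implicit {S : Set E} {R : Set (E × ℝ)} {G : E × ℝ → ℝ} {σ : E → ℝ}
    {L : E × ℝ →L[ℝ] ℝ} {u : E} (hu : u ∈ S) (hG : HasFDerivWithinAt G L R (u, σ u))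
    (hL : L (0, 1) ≠ 0) (hσ : ContinuousWithinAt σ S u) (hR : ∀ v ∈ S, (v, σ v) ∈ R)
    (h0 : ∀ v ∈ S, G (v, σ v) = 0) :
    HasFDerivWithinAt σ (-((L (0, 1))⁻¹ • L.comp (.inl ℝ E ℝ))) S u := by
  -- The map `(v, s) ↦ (v, G (v, s))` sends the graph of `σ` to `(v, 0)`, and `L (0, 1) ≠ 0` makes
  -- its derivative left invertible; the inverse yields the derivative of `σ`.
  have hf : HasFDerivWithinAt (fun p : E × ℝ => (p.1, G p))
      ((ContinuousLinearMap.fst ℝ E ℝ).prod L) R (u, σ u) := hasFDerivWithinAt_fst.prodMk hG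
  have hh : HasFDerivWithinAt (fun v : E => (v, (0 : ℝ))) (.inl ℝ E ℝ) S u :=
    (hasFDerivAt_prodMk_left u 0).hasFDerivWithinAt
  have hst : Tendsto (fun v => (v, σ v)) (𝓝[S] u) (𝓝[R] (u, σ u)) :=
    tendsto_nhdsWithin_iff.2 ⟨(continuousWithinAt_id.prodMk hσ).tendsto,
      eventually_mem_nhdsWithin.mono hR⟩
  have hsymm : Function.LeftInverse
      ((ContinuousLinearMap.fst ℝ E ℝ).prod ((L (0, 1))⁻¹ •
        (ContinuousLinearMap.snd ℝ E ℝ - (L.comp (.inl ℝ E ℝ)).comp (.fst ℝ E ℝ))))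
      ((ContinuousLinearMap.fst ℝ E ℝ).prod L) := by
    rintro ⟨v, s⟩
    have hvs : L (v, s) = L (v, 0) + s * L (0, 1) := by
      rw [← smul_eq_mul, ← map_smul, ← map_add]; simp
    simp only [ContinuousLinearMap.prod_apply, _root_.smul_apply, _root_.sub_apply,
      ContinuousLinearMap.comp_apply, ContinuousLinearMap.coe_fst', ContinuousLinearMap.coe_snd',
      ContinuousLinearMap.inl_apply, hvs, add_sub_cancel_left, smul_eq_mul]
    rw [mul_comm s, inv_mul_cancel_left₀ hL]
  have := HasFDerivWithinAt.of_comp_of_leftInverse (g := fun v => (v, σ v)) hst hf hh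
    (eventually_mem_nhdsWithin.mono fun v hv => by simp [h0 v hv]) hsymm hu
  refine this.snd.congr_fderiv ?_
  ext v
  simp

/-- An implicit function theorem for a scalar equation whose parameter varies in a set of unique
differentiability. -/
theorem exists_contDiffOn_implicit {S : Set E} (hS : UniqueDiffOn ℝ S) {O : Set (E × ℝ)}
    (hO : IsOpen O) {G : E × ℝ → ℝ} (hG : ContDiffOn ℝ ∞ G (S ×ˢ univ ∩ O)) {u₀ : E} (hu₀ : u₀ ∈ S)
    (hO₀ : (u₀, (0 : ℝ)) ∈ O) (h0 : G (u₀, 0) = 0) {c : ℝ} (hc : 0 < c)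
    (hd : HasDerivAt (fun s => G (u₀, s)) c 0) :
    ∃ (U : Set E) (δ : ℝ) (σ : E → ℝ), IsOpen U ∧ u₀ ∈ U ∧ 0 < δ ∧ ContDiffOn ℝ ∞ σ (S ∩ U) ∧
      (∀ u ∈ S ∩ U, |σ u| < δ ∧ G (u, σ u) = 0) ∧
      ∀ u ∈ S ∩ U, ∀ s, |s| < δ → G (u, s) = 0 → s = σ u := by
  set R : Set (E × ℝ) := S ×ˢ univ ∩ O with hR
  have hRU : UniqueDiffOn ℝ R := (hS.prod uniqueDiffOn_univ).inter hO
  have hGd : ∀ p ∈ R, HasFDerivWithinAt G (fderivWithin ℝ G R p) R p := fun p hp =>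
    (hG.differentiableOn (by simp) p hp).hasFDerivWithinAt
  have hG' : ContDiffOn ℝ ∞ (fderivWithin ℝ G R) R := hG.fderivWithin hRU (by simp)
  set d : E × ℝ → ℝ := fun p => fderivWithin ℝ G R p (0, 1) with hd_def
  have hdc : ContinuousOn d R := hG'.continuousOn.clm_apply continuousOn_const
  have hderiv : ∀ u ∈ S, ∀ s, (u, s) ∈ O → HasDerivAt (fun s => G (u, s)) (d (u, s)) s := by
    intro u hu s hs
    have h1 : HasDerivWithinAt (fun s : ℝ => (u, s)) (0, 1) {s | (u, s) ∈ O} s :=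
      ((hasDerivAt_const s u).prodMk (hasDerivAt_id s)).hasDerivWithinAt
    have h2 := (hGd (u, s) ⟨⟨hu, mem_univ _⟩, hs⟩).comp_hasDerivWithinAt s h1
      fun s' hs' => ⟨⟨hu, mem_univ _⟩, hs'⟩
    exact h2.hasDerivAt ((hO.preimage (Continuous.prodMk_right u)).mem_nhds hs)
  have hp₀ : (u₀, (0 : ℝ)) ∈ R := ⟨⟨hu₀, mem_univ _⟩, hO₀⟩
  have hd₀ : 0 < d (u₀, 0) := by
    rw [(hderiv u₀ hu₀ 0 hO₀).unique hd]; exact hc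
  have hev : ∀ᶠ p in 𝓝[S ×ˢ univ] (u₀, (0 : ℝ)), p ∈ O ∧ 0 < d p := by
    have h1 : 𝓝[R] (u₀, (0 : ℝ)) = 𝓝[S ×ˢ univ] (u₀, (0 : ℝ)) :=
      nhdsWithin_inter_of_mem' (mem_nhdsWithin_of_mem_nhds (hO.mem_nhds hO₀))
    rw [← h1]
    filter_upwards [self_mem_nhdsWithin, (hdc _ hp₀).eventually (lt_mem_nhds hd₀)] with p h1 h2
    exact ⟨h1.2, h2⟩
  rw [nhdsWithin_prod_eq, nhdsWithin_univ] at hev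
  obtain ⟨A, hA, B, hB, hAB⟩ := eventually_prod_iff.1 hev
  obtain ⟨δ₁, hδ₁, hBδ⟩ := Metric.eventually_nhds_iff.1 hB
  obtain ⟨U₁, hU₁, hu₁, hUA⟩ := mem_nhdsWithin.1 hA
  -- Halving puts the closed interval `[-δ, δ]` inside the range where `G` is defined with positive
  -- `s`-derivative.
  set δ := δ₁ / 2 with hδ_def
  have hδ : 0 < δ := half_pos hδ₁
  have hbox : ∀ u ∈ S ∩ U₁, ∀ s ∈ Icc (-δ) δ, (u, s) ∈ O ∧ 0 < d (u, s) := by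
    intro u hu s hs
    refine hAB (hUA ⟨hu.2, hu.1⟩) (hBδ ?_)
    rw [Real.dist_eq, sub_zero]
    exact (abs_le.2 hs).trans_lt (half_lt_self hδ₁)
  have hmono : ∀ u ∈ S ∩ U₁, StrictMonoOn (fun s => G (u, s)) (Icc (-δ) δ) := by
    intro u hu
    refine strictMonoOn_of_deriv_pos (convex_Icc _ _) (fun s hs => ?_) fun s hs => ?_
    · exact (hderiv u hu.1 s (hbox u hu s hs).1).continuousAt.continuousWithinAt
    · have hs' := interior_subset hs
      rw [(hderiv u hu.1 s (hbox u hu s hs').1).deriv]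
      exact (hbox u hu s hs').2
  have hcont : ∀ u ∈ S ∩ U₁, ∀ s ∈ Icc (-δ) δ, ContinuousWithinAt (fun v => G (v, s)) S u := by
    intro u hu s hs
    have h1 : ContinuousWithinAt G R (u, s) :=
      hG.continuousOn _ ⟨⟨hu.1, mem_univ _⟩, (hbox u hu s hs).1⟩
    refine h1.tendsto.comp (tendsto_nhdsWithin_iff.2 ⟨?_, ?_⟩)
    · exact ((Continuous.prodMk_left s).tendsto u).mono_left nhdsWithin_le_nhds
    · have h2 : ∀ᶠ v in 𝓝[S] u, (v, s) ∈ O := mem_nhdsWithin_of_mem_nhds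
        ((hO.preimage (Continuous.prodMk_left s)).mem_nhds (hbox u hu s hs).1)
      filter_upwards [h2, self_mem_nhdsWithin] with v h3 h4 using ⟨⟨h4, mem_univ _⟩, h3⟩
  have hu₀' : u₀ ∈ S ∩ U₁ := ⟨hu₀, hu₁⟩
  have hl : -δ ∈ Icc (-δ) δ := ⟨le_rfl, by linarith⟩
  have hr : δ ∈ Icc (-δ) δ := ⟨by linarith, le_rfl⟩
  have hz : (0 : ℝ) ∈ Icc (-δ) δ := ⟨by linarith, hδ.le⟩
  have hneg : G (u₀, -δ) < 0 := by
    have := hmono u₀ hu₀' hl hz (by linarith); simpa [h0] using this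
  have hpos : 0 < G (u₀, δ) := by
    have := hmono u₀ hu₀' hz hr hδ; simpa [h0] using this
  have hends : ∀ᶠ u in 𝓝[S] u₀, G (u, -δ) < 0 ∧ 0 < G (u, δ) :=
    ((hcont u₀ hu₀' _ hl).eventually (gt_mem_nhds hneg)).and
      ((hcont u₀ hu₀' _ hr).eventually (lt_mem_nhds hpos))
  obtain ⟨U₂, hU₂, hu₂, hU₂'⟩ := mem_nhdsWithin.1 hends
  -- The signs of `G` at `±δ` persist for `u` near `u₀`, so a root exists; monotonicity in `s` makes
  -- it unique.
  have hroot : ∀ u ∈ S ∩ (U₁ ∩ U₂), ∃ s ∈ Ioo (-δ) δ, G (u, s) = 0 := by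
    intro u hu
    have hc : ContinuousOn (fun s => G (u, s)) (Icc (-δ) δ) := fun s hs =>
      (hderiv u hu.1 s (hbox u ⟨hu.1, hu.2.1⟩ s hs).1).continuousAt.continuousWithinAt
    exact intermediate_value_Ioo (by linarith) hc (hU₂' ⟨hu.2.2, hu.1⟩)
  choose! σ hσ hσ0 using hroot
  set S' := S ∩ (U₁ ∩ U₂) with hS'
  have hS'1 : ∀ u ∈ S', u ∈ S ∩ U₁ := fun u hu => ⟨hu.1, hu.2.1⟩
  have hS'U : UniqueDiffOn ℝ S' := hS.inter (hU₁.inter hU₂)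
  have hσR : ∀ u ∈ S', (u, σ u) ∈ R := fun u hu =>
    ⟨⟨hu.1, mem_univ _⟩, (hbox u (hS'1 u hu) _ (Ioo_subset_Icc_self (hσ u hu))).1⟩
  have hσcont : ContinuousOn σ S' := by
    intro u hu
    have hσu := hσ u hu
    refine tendsto_order.2 ⟨fun a ha => ?_, fun a ha => ?_⟩
    -- Clamping `a` keeps the comparison inside the interval of monotonicity; there the sign of `G`
    -- tells on which side of `σ` a value lies.
    · have ha' : max a (-δ) ∈ Icc (-δ) δ :=
        ⟨le_max_right _ _, max_le (ha.le.trans hσu.2.le) (by linarith)⟩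
      have h1 : G (u, max a (-δ)) < 0 := by
        rw [← hσ0 u hu]
        exact hmono u (hS'1 u hu) ha' (Ioo_subset_Icc_self hσu) (max_lt ha hσu.1)
      filter_upwards [((hcont u (hS'1 u hu) _ ha').mono inter_subset_left).eventually
        (gt_mem_nhds h1), self_mem_nhdsWithin] with v h2 h3
      rw [← hσ0 v h3] at h2
      exact (le_max_left _ _).trans_lt (((hmono v (hS'1 v h3)).lt_iff_lt ha'
        (Ioo_subset_Icc_self (hσ v h3))).1 h2)
    · have ha' : min a δ ∈ Icc (-δ) δ :=
        ⟨le_min (hσu.1.le.trans ha.le) (by linarith), min_le_right _ _⟩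
      have h1 : 0 < G (u, min a δ) := by
        rw [← hσ0 u hu]
        exact hmono u (hS'1 u hu) (Ioo_subset_Icc_self hσu) ha' (lt_min ha hσu.2)
      filter_upwards [((hcont u (hS'1 u hu) _ ha').mono inter_subset_left).eventually
        (lt_mem_nhds h1), self_mem_nhdsWithin] with v h2 h3
      rw [← hσ0 v h3] at h2
      exact (((hmono v (hS'1 v h3)).lt_iff_lt (Ioo_subset_Icc_self (hσ v h3)) ha').1 h2).trans_le
        (min_le_left _ _)
  have hdσ : ∀ u ∈ S', d (u, σ u) ≠ 0 := fun u hu =>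
    (hbox u (hS'1 u hu) _ (Ioo_subset_Icc_self (hσ u hu))).2.ne'
  have hσd : ∀ u ∈ S', HasFDerivWithinAt σ (-((d (u, σ u))⁻¹ •
      (fderivWithin ℝ G R (u, σ u)).comp (.inl ℝ E ℝ))) S' u := fun u hu =>
    hasFDerivWithinAt_of_implicit hu (hGd _ (hσR u hu)) (hdσ u hu) (hσcont u hu) hσR hσ0
  -- Bootstrapping: the derivative of `σ` is a smooth expression in the derivative of `G` along the
  -- graph, so `σ` of class C^n is of class C^(n+1).
  have hσn : ∀ n : ℕ, ContDiffOn ℝ n σ S' := by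
    intro n
    induction n with
    | zero => exact contDiffOn_zero.2 hσcont
    | succ n ih =>
      push_cast
      refine (contDiffOn_succ_iff_hasFDerivWithinAt_of_uniqueDiffOn hS'U).2
        ⟨fun h => by simp at h, _, ?_, hσd⟩
      have h1 : ContDiffOn ℝ n (fun u => fderivWithin ℝ G R (u, σ u)) S' :=
        (hG'.of_le (by exact_mod_cast le_top)).comp (contDiffOn_id.prodMk ih) hσR
      have h2 : ContDiffOn ℝ n (fun u => d (u, σ u)) S' := h1.clm_apply contDiffOn_const
      exact ((h2.inv hdσ).smul (h1.clm_comp contDiffOn_const)).neg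
  refine ⟨U₁ ∩ U₂, δ, σ, hU₁.inter hU₂, ⟨hu₁, hu₂⟩, hδ, contDiffOn_infty.2 hσn,
    fun u hu => ⟨abs_lt.2 (hσ u hu), hσ0 u hu⟩, fun u hu s hs hs0 => ?_⟩
  exact (hmono u (hS'1 u hu)).injOn (Ioo_subset_Icc_self (abs_lt.1 hs))
    (Ioo_subset_Icc_self (hσ u hu)) (hs0.trans (hσ0 u hu).symm)

end Implicit

/-! ### Local flows and flow boxes -/

section FlowLemmas

variable {E : Type*} [NormedAddCommGroup E] [NormedSpace ℝ E] {H : Type*} [TopologicalSpace H]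
  {I : ModelWithCorners ℝ E H} {M : Type*} [TopologicalSpace M] [ChartedSpace H M]
  {F : (x : M) → TangentSpace I x} {D : Set (M × ℝ)} {Φ : M → ℝ → M}

namespace IsLocalFlow

lemma isOpen_slice (h : IsLocalFlow I F D Φ) (x : M) : IsOpen {t : ℝ | (x, t) ∈ D} :=
  h.isOpen_domain.preimage (Continuous.prodMk_right x)

/-- The translated curve `t ↦ Φ x (t + a)` is an integral curve through `Φ x a`, so maximality
applies to it. -/
lemma map_add (h : IsLocalFlow I F D Φ) {x : M} {a s : ℝ} (ha : (x, a) ∈ D)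
    (hs : (x, a + s) ∈ D) : (Φ x a, s) ∈ D ∧ Φ (Φ x a) s = Φ x (a + s) := by
  have h1 := (h.isMIntegralCurveOn x).comp_add a
  have h2 := h.maximal (Φ x a) (Φ x ∘ (· + a)) {t | t + a ∈ {t : ℝ | (x, t) ∈ D}}
    ((h.isOpen_slice x).preimage (continuous_add_const a))
    ⟨fun t ht t' ht' r hr => (h.ordConnected x).out ht ht'
      ⟨by linarith [hr.1], by linarith [hr.2]⟩⟩
    (by simpa using ha) (by simp) h1 s (by simpa [add_comm s a] using hs)
  exact ⟨h2.1, by rw [← h2.2]; simp [add_comm s a]⟩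

/-- Flowing back by `-a` returns to `x`; then `map_add` is applied from `Φ x a` with the times `-a`
and `a + s`. -/
lemma add_mem (h : IsLocalFlow I F D Φ) {x : M} {a s : ℝ} (ha : (x, a) ∈ D)
    (hs : (Φ x a, s) ∈ D) : (x, a + s) ∈ D := by
  have h1 := h.map_add (s := -a) ha (by simpa using h.zero_mem x)
  have h2 := h.map_add (x := Φ x a) (a := -a) (s := a + s) h1.1 (by simpa using hs)
  have h3 : Φ (Φ x a) (-a) = x := by rw [h1.2]; simp [h.map_zero]
  rw [h3] at h2
  exact h2.1

/-- On a periodic orbit `a` and `b` may differ by a period, but what follows depends only on the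
point reached. -/
lemma shift_of_eq (h : IsLocalFlow I F D Φ) {x : M} {a b s : ℝ} (ha : (x, a) ∈ D)
    (hb : (x, b) ∈ D) (hab : Φ x a = Φ x b) (hs : (x, a + s) ∈ D) :
    (x, b + s) ∈ D ∧ Φ x (b + s) = Φ x (a + s) := by
  have h1 := h.map_add ha hs
  rw [hab] at h1
  have h2 := h.add_mem hb h1.1
  exact ⟨h2, by rw [← (h.map_add hb h2).2, h1.2]⟩

lemma of_singular (h : IsLocalFlow I F D Φ) {x : M} (hx : F x = 0) (t : ℝ) :
    (x, t) ∈ D ∧ Φ x t = x := by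
  have := h.maximal x (fun _ => x) univ isOpen_univ ordConnected_univ (mem_univ _) rfl
    ((isMIntegralCurve_const hx).isMIntegralCurveOn _) t (mem_univ _)
  exact ⟨this.1, this.2.symm⟩

lemma nonsingular (h : IsLocalFlow I F D Φ) {x : M} {t : ℝ} (ht : (x, t) ∈ D)
    (hx : x ∉ singularSet I F) : Φ x t ∉ singularSet I F := by
  intro h0
  have h1 := h.map_add (s := -t) ht (by simpa using h.zero_mem x)
  rw [(h.of_singular h0 (-t)).2, add_neg_cancel, h.map_zero] at h1
  exact hx (h1.2 ▸ h0)

lemma mem_orbit_self (h : IsLocalFlow I F D Φ) (x : M) : x ∈ orbit D Φ x :=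
  ⟨0, h.zero_mem x, h.map_zero x⟩

lemma mem_orbit_trans (h : IsLocalFlow I F D Φ) {x y z : M} (hy : y ∈ orbit D Φ x)
    (hz : z ∈ orbit D Φ y) : z ∈ orbit D Φ x := by
  obtain ⟨a, ha, rfl⟩ := hy
  obtain ⟨b, hb, rfl⟩ := hz
  have := h.add_mem ha hb
  exact ⟨a + b, this, (h.map_add ha this).2.symm⟩

lemma orbit_of_singular (h : IsLocalFlow I F D Φ) {x y : M} (hx : F x = 0)
    (hy : y ∈ orbit D Φ x) : y = x := by
  obtain ⟨t, _, rfl⟩ := hy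
  exact (h.of_singular hx t).2

lemma nonsingular_of_mem_orbit (h : IsLocalFlow I F D Φ) {x y : M} (hx : x ∉ singularSet I F)
    (hy : y ∈ orbit D Φ x) : y ∉ singularSet I F := by
  obtain ⟨t, ht, rfl⟩ := hy
  exact h.nonsingular ht hx

lemma smul_mem (h : IsLocalFlow I F D Φ) {x : M} {a c : ℝ} (ha : (x, a) ∈ D) (h0 : 0 ≤ c)
    (h1 : c ≤ 1) : (x, c * a) ∈ D := by
  refine (h.ordConnected x).uIcc_subset (h.zero_mem x) ha ?_
  rcases le_total 0 a with h2 | h2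
  · rw [uIcc_of_le h2]
    exact ⟨by positivity, by nlinarith⟩
  · rw [uIcc_of_ge h2]
    exact ⟨by nlinarith, mul_nonpos_of_nonneg_of_nonpos h0 h2⟩

end IsLocalFlow

/-- A function `τ` on an open set `U` of points which can be flowed for time `τ`, and which
decreases at unit speed along the flow: the time needed to reach a transversal. -/
structure IsFlowBox (I : ModelWithCorners ℝ E H) (D : Set (M × ℝ)) (Φ : M → ℝ → M) (U : Set M)
    (τ : M → ℝ) : Prop where
  isOpen : IsOpen U
  contMDiffOn : ContMDiffOn I 𝓘(ℝ, ℝ) ∞ τ U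
  mem : ∀ x ∈ U, (x, τ x) ∈ D
  map_flow : ∀ x ∈ U, ∀ᶠ s in 𝓝 (0 : ℝ), τ (Φ x s) = τ x - s

lemma IsLocalFlow.eventually_zero (h : IsLocalFlow I F D Φ) (x : M) :
    ∀ᶠ s in 𝓝 (0 : ℝ), (x, s) ∈ D := (h.isOpen_slice x).mem_nhds (h.zero_mem x)

lemma IsLocalFlow.continuousAt (h : IsLocalFlow I F D Φ) {x : M} {t : ℝ} (ht : (x, t) ∈ D) :
    ContinuousAt (Φ x) t :=
  ((h.isMIntegralCurveOn x).continuousWithinAt ht).continuousAt ((h.isOpen_slice x).mem_nhds ht)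

/-- The transversal is a level set, in a chart, of a linear functional `ℓ` equal to 1 on the
velocity at `p`. The hitting time `τ` comes from the implicit function theorem over `range I`, so
boundary points are included. -/
theorem IsLocalFlow.exists_isFlowBox [IsManifold I ∞ M] (h : IsLocalFlow I F D Φ) {p : M}
    (hp : p ∉ singularSet I F) : ∃ U τ, p ∈ U ∧ IsFlowBox I D Φ U τ := by
  have : IsManifold I 1 M := IsManifold.of_le (n := ∞) (by simp)
  obtain ⟨v, hv, hder⟩ : ∃ v : E, v ≠ 0 ∧ HasDerivAt (extChartAt I p ∘ Φ p) v 0 := by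
    have h1 := (h.isMIntegralCurveOn p).hasDerivWithinAt (h.zero_mem p)
      (mem_extChartAt_source (I := I) (Φ p 0))
    have h2 := h1.hasDerivAt ((h.isOpen_slice p).mem_nhds (h.zero_mem p))
    have h3 := h2.congr_deriv (tangentCoordChange_self (E := E) (I := I) (v := F (Φ p 0))
      (mem_extChartAt_source (I := I) (Φ p 0)))
    have h4 : (F (Φ p 0) : E) ≠ 0 := h.nonsingular (h.zero_mem p) hp
    generalize (F (Φ p 0) : E) = v at h3 h4
    rw [h.map_zero] at h3
    exact ⟨v, h4, h3⟩
  obtain ⟨ℓ, hℓ⟩ := SeparatingDual.exists_eq_one (R := ℝ) hv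
  set ψ := extChartAt I p with hψ
  set e := ψ p with he
  set T₀ : Set E := I.symm ⁻¹' (chartAt H p).target with hT₀
  have hT₀o : IsOpen T₀ := (chartAt H p).open_target.preimage I.continuous_symm
  have htarget : ψ.target = T₀ ∩ range I := by
    rw [hψ, extChartAt, OpenPartialHomeomorph.extend_target]
  have hsymmc : ContinuousOn (fun q : E × ℝ => (ψ.symm q.1, q.2)) (T₀ ×ˢ univ) := by
    have h1 : ContinuousOn ψ.symm T₀ := by
      rw [hψ, extChartAt_coe_symm]
      exact (chartAt H p).continuousOn_symm.comp I.continuous_symm.continuousOn fun u hu => hu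
    exact (h1.comp continuousOn_fst fun q hq => hq.1).prodMk continuousOn_snd
  have hD' : IsOpen (D ∩ (fun q : M × ℝ => Φ q.1 q.2) ⁻¹' ψ.source) :=
    h.contMDiffOn.continuousOn.isOpen_inter_preimage h.isOpen_domain
      (isOpen_extChartAt_source (I := I) p)
  set O : Set (E × ℝ) := T₀ ×ˢ univ ∩ (fun q : E × ℝ => (ψ.symm q.1, q.2)) ⁻¹'
    (D ∩ (fun q : M × ℝ => Φ q.1 q.2) ⁻¹' ψ.source) with hO
  have hOo : IsOpen O := hsymmc.isOpen_inter_preimage (hT₀o.prod isOpen_univ) hD'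
  set G : E × ℝ → ℝ := fun q => ℓ (ψ (Φ (ψ.symm q.1) q.2)) - ℓ e with hG
  have hGsmooth : ContDiffOn ℝ ∞ G (range I ×ˢ univ ∩ O) := by
    rw [← contMDiffOn_iff_contDiffOn]
    have h1 : ContMDiffOn 𝓘(ℝ, E × ℝ) I ∞ (fun q : E × ℝ => ψ.symm q.1)
        (range I ×ˢ univ ∩ O) :=
      (contMDiffOn_extChartAt_symm p).comp
        (contDiff_fst.contDiffOn.contMDiffOn (s := range I ×ˢ univ ∩ O)) fun q hq => by
          change q.1 ∈ ψ.target
          rw [htarget]; exact ⟨hq.2.1.1, hq.1.1⟩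
    have h2 : ContMDiffOn 𝓘(ℝ, E × ℝ) 𝓘(ℝ, ℝ) ∞ (fun q : E × ℝ => q.2)
        (range I ×ˢ univ ∩ O) := contDiff_snd.contDiffOn.contMDiffOn
    have h3 := h.contMDiffOn.comp (h1.prodMk h2) fun q hq => hq.2.2.1
    have h4 := (contMDiffOn_extChartAt (I := I) (n := ∞) (x := p)).comp h3 fun q hq => by
      rw [← extChartAt_source I]; exact hq.2.2.2
    have h5 : ContMDiff 𝓘(ℝ, E) 𝓘(ℝ, ℝ) ∞ (fun w : E => ℓ w - ℓ e) :=
      (ℓ.contDiff.sub contDiff_const).contMDiff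
    exact h5.comp_contMDiffOn h4
  have hps : p ∈ ψ.source := mem_extChartAt_source (I := I) p
  have hsymm : ψ.symm e = p := ψ.left_inv hps
  have he_mem : e ∈ ψ.target := ψ.map_source hps
  have heO : (e, (0 : ℝ)) ∈ O := by
    refine ⟨⟨?_, mem_univ _⟩, ?_, ?_⟩
    · rw [htarget] at he_mem; exact he_mem.1
    · change (ψ.symm e, (0 : ℝ)) ∈ D
      rw [hsymm]; exact h.zero_mem p
    · change Φ (ψ.symm e) 0 ∈ ψ.source
      rw [hsymm, h.map_zero]; exact hps
  have hG0 : G (e, 0) = 0 := by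
    simp only [hG]; rw [hsymm, h.map_zero]; exact sub_self _
  have hGd : HasDerivAt (fun s => G (e, s)) 1 0 := by
    have h1 := (ℓ.hasFDerivAt.comp_hasDerivAt (0 : ℝ) hder).sub_const (ℓ e)
    rw [hℓ] at h1
    simp only [hG, hsymm]
    exact h1
  obtain ⟨U₀, δ, σ, hU₀, heU, hδ, hσ, hσ0, hσu⟩ := exists_contDiffOn_implicit I.uniqueDiffOn hOo
    hGsmooth (by rw [htarget] at he_mem; exact he_mem.2) heO hG0 one_pos hGd
  set τ : M → ℝ := fun x => σ (ψ x) with hτ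
  have hU₁ : IsOpen (ψ.source ∩ ψ ⁻¹' U₀) :=
    (continuousOn_extChartAt p).isOpen_inter_preimage (isOpen_extChartAt_source (I := I) p) hU₀
  have hmemU : ∀ x ∈ ψ.source ∩ ψ ⁻¹' U₀, ψ x ∈ range I ∩ U₀ := fun x hx =>
    ⟨extChartAt_target_subset_range (I := I) p (ψ.map_source hx.1), hx.2⟩
  have hτs : ContMDiffOn I 𝓘(ℝ, ℝ) ∞ τ (ψ.source ∩ ψ ⁻¹' U₀) :=
    hσ.contMDiffOn.comp ((contMDiffOn_extChartAt (I := I) (n := ∞) (x := p)).mono fun x hx => by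
      rw [← extChartAt_source I]; exact hx.1) hmemU
  have hU₂ : IsOpen (ψ.source ∩ ψ ⁻¹' U₀ ∩ (fun x => (x, τ x)) ⁻¹' D) :=
    (continuousOn_id.prodMk hτs.continuousOn).isOpen_inter_preimage hU₁ h.isOpen_domain
  have hpU₁ : p ∈ ψ.source ∩ ψ ⁻¹' U₀ := ⟨hps, heU⟩
  have hτp : τ p = 0 := (hσu e (hmemU p hpU₁) 0 (by simpa using hδ) hG0).symm
  refine ⟨ψ.source ∩ ψ ⁻¹' U₀ ∩ (fun x => (x, τ x)) ⁻¹' D, τ, ⟨hpU₁, ?_⟩, hU₂, hτs.mono inter_subset_left, fun x hx => hx.2, fun x hx => ?_⟩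
  · change (p, τ p) ∈ D
    rw [hτp]; exact h.zero_mem p
  · have hx0 := h.continuousAt (h.zero_mem x)
    have h1 : ∀ᶠ s in 𝓝 (0 : ℝ), Φ x s ∈ ψ.source ∩ ψ ⁻¹' U₀ :=
      hx0.eventually_mem (by rw [h.map_zero]; exact hU₁.mem_nhds hx.1)
    have h2 : ∀ᶠ s in 𝓝 (0 : ℝ), |τ x - s| < δ := by
      have : ContinuousAt (fun s : ℝ => |τ x - s|) 0 := by fun_prop
      exact this.eventually (gt_mem_nhds (by simpa using (hσ0 _ (hmemU x hx.1)).1))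
    filter_upwards [h1, h2, h.eventually_zero x] with s hs1 hs2 hs3
    -- From `Φ x s`, the time `τ x - s` leads to the point of the transversal that `x` reaches at
    -- time `τ x`; uniqueness of the small hitting time identifies it with `τ (Φ x s)`.
    refine (hσu (ψ (Φ x s)) (hmemU _ hs1) _ hs2 ?_).symm
    have h3 := (h.map_add (s := τ x - s) hs3 (by simpa using hx.2)).2
    rw [add_sub_cancel] at h3
    have h4 := (hσ0 _ (hmemU x hx.1)).2
    simp only [hG] at h4 ⊢
    rw [ψ.left_inv hx.1.1] at h4
    rw [ψ.left_inv hs1.1, h3]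
    exact h4

end FlowLemmas

/-! ### Lifting paths in an orbit to flow time -/

section Lifting

variable {E : Type*} [NormedAddCommGroup E] [NormedSpace ℝ E] {H : Type*} [TopologicalSpace H]
  {I : ModelWithCorners ℝ E H} {M : Type*} [TopologicalSpace M] [ChartedSpace H M]
  {F : (x : M) → TangentSpace I x} {D : Set (M × ℝ)} {Φ : M → ℝ → M}

lemma IsFlowBox.flow_eq {U : Set M} {τ : M → ℝ} (hU : IsFlowBox I D Φ U τ)
    (h : IsLocalFlow I F D Φ) {x : M} (hx : x ∈ U) :
    ∀ᶠ s in 𝓝 (0 : ℝ), Φ (Φ x s) (τ (Φ x s)) = Φ x (τ x) := by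
  filter_upwards [hU.map_flow x hx, h.eventually_zero x] with s h1 h2
  have h3 := (h.map_add (s := τ x - s) h2 (by simpa using hU.mem x hx)).2
  rw [h1, h3, add_sub_cancel]

/-- A continuous path in an orbit which stays in a flow box stays in one plaque of the flow box. -/
lemma IsFlowBox.flow_eq_of_path [TopologicalSpace.MetrizableSpace M] {T : Type*} [TopologicalSpace T]
    [PreconnectedSpace T] {U : Set M} {τ : M → ℝ} (hU : IsFlowBox I D Φ U τ)
    (h : IsLocalFlow I F D Φ) {y : M} {γ : T → M} (hγ : Continuous γ) (hγU : ∀ t, γ t ∈ U)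
    (hγy : ∀ t, γ t ∈ orbit D Φ y) (s t : T) : Φ (γ s) (τ (γ s)) = Φ (γ t) (τ (γ t)) := by
  set π : M → M := fun x => Φ x (τ x) with hπ
  have hπc : ContinuousOn π U :=
    h.contMDiffOn.continuousOn.comp (continuousOn_id.prodMk hU.contMDiffOn.continuousOn)
      fun x hx => hU.mem x hx
  set A : Set ℝ := {r | (y, r) ∈ D ∧ Φ y r ∈ U} with hA
  have hloc : ∀ r ∈ A, ∀ᶠ r' in 𝓝 r, π (Φ y r') = π (Φ y r) := by
    intro r hr
    have htend : Tendsto (fun r' => r' - r) (𝓝 r) (𝓝 0) := by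
      have : Continuous fun r' : ℝ => r' - r := by fun_prop
      exact this.tendsto' _ _ (sub_self r)
    filter_upwards [htend.eventually (hU.flow_eq h hr.2),
      (h.isOpen_slice y).mem_nhds hr.1] with r' h1 h2
    have h3 := (h.map_add (s := r' - r) hr.1 (by simpa using h2)).2
    rw [h3, add_sub_cancel] at h1
    exact h1
  -- The orbit may return to the box infinitely often, but `π` along it is locally constant in time,
  -- so each value is attained at a rational time. A connected set inside a countable subset of a
  -- metric space is at most one point.
  have hcount : ((fun r => π (Φ y r)) '' A).Countable := by
    refine ((countable_range (fun q : ℚ => π (Φ y q)))).mono ?_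
    rintro _ ⟨r, hr, rfl⟩
    obtain ⟨q, hq⟩ := Rat.denseRange_cast.exists_mem_open isOpen_interior
      ⟨r, mem_interior_iff_mem_nhds.2 (hloc r hr)⟩
    have hq' : π (Φ y q) = π (Φ y r) := by
      have := interior_subset hq
      exact this
    exact ⟨q, hq'⟩
  let := TopologicalSpace.metrizableSpaceMetric M
  have hpre : IsPreconnected (range (π ∘ γ)) :=
    isPreconnected_range (hπc.comp_continuous hγ hγU)
  refine hcount.isTotallyDisconnected _ ?_ hpre ⟨s, rfl⟩ ⟨t, rfl⟩
  rintro _ ⟨r, rfl⟩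
  obtain ⟨a, ha, hay⟩ := hγy r
  exact ⟨a, ⟨ha, hay ▸ hγU r⟩, by simp only [Function.comp]; rw [hay]⟩

/-- Along a path in an orbit which stays in a flow box, the change of the flow box coordinate is
the time along the flow. -/
lemma IsFlowBox.map_path [TopologicalSpace.MetrizableSpace M] {T : Type*} [TopologicalSpace T]
    [PreconnectedSpace T] {U : Set M} {τ : M → ℝ} (hU : IsFlowBox I D Φ U τ)
    (h : IsLocalFlow I F D Φ) {y : M} {γ : T → M} (hγ : Continuous γ) (hγU : ∀ t, γ t ∈ U)
    (hγy : ∀ t, γ t ∈ orbit D Φ y) {s : T} {a : ℝ} (ha : (y, a) ∈ D) (has : Φ y a = γ s) (t : T) :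
    (y, a + (τ (γ s) - τ (γ t))) ∈ D ∧ Φ y (a + (τ (γ s) - τ (γ t))) = γ t := by
  have h1 := hU.flow_eq_of_path h hγ hγU hγy s t
  -- From `γ s` flow to the common point of the transversal, then back for time `τ (γ t)` to `γ t`.
  have h2 := h.map_add (s := -τ (γ t)) (hU.mem _ (hγU t)) (by simpa using h.zero_mem _)
  rw [← h1, add_neg_cancel, h.map_zero] at h2
  have h3 := h.add_mem (hU.mem _ (hγU s)) h2.1
  have h4 := h.map_add (hU.mem _ (hγU s)) h3
  rw [h2.2, ← sub_eq_add_neg] at h4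
  rw [← sub_eq_add_neg] at h3
  have h5 := h.add_mem (x := y) ha (by rw [has]; exact h3)
  exact ⟨h5, by rw [← (h.map_add ha h5).2, has, ← h4.2]⟩

/-- In a flow box around `Φ x r`, the coordinate `τ` is affine of slope `-1` along the orbit. -/
lemma IsLocalFlow.eventually_injective [IsManifold I ∞ M] (h : IsLocalFlow I F D Φ) {x : M} {r : ℝ}
    (hr : (x, r) ∈ D) (hx : x ∉ singularSet I F) :
    ∃ B ∈ 𝓝 r, InjOn (Φ x) B := by
  obtain ⟨U, τ, hp, hU⟩ := h.exists_isFlowBox (h.nonsingular hr hx)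
  have htend : Tendsto (fun r' => r' - r) (𝓝 r) (𝓝 0) := by
    have : Continuous fun r' : ℝ => r' - r := by fun_prop
    exact this.tendsto' _ _ (sub_self r)
  have hev : ∀ᶠ r' in 𝓝 r, τ (Φ x r') = τ (Φ x r) - (r' - r) := by
    filter_upwards [htend.eventually (hU.map_flow _ hp), (h.isOpen_slice x).mem_nhds hr]
      with r' h1 h2
    have h3 := (h.map_add (s := r' - r) hr (by simpa using h2)).2
    rw [h3, add_sub_cancel] at h1
    exact h1
  refine ⟨_, hev, fun r₁ h₁ r₂ h₂ h12 => ?_⟩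
  have e₁ : τ (Φ x r₁) = τ (Φ x r) - (r₁ - r) := h₁
  have e₂ : τ (Φ x r₂) = τ (Φ x r) - (r₂ - r) := h₂
  rw [h12, e₂] at e₁
  linarith

/-- Uniqueness of continuous lifts of a path in an orbit to flow time. -/
lemma IsLocalFlow.lift_unique [IsManifold I ∞ M] (h : IsLocalFlow I F D Φ) {x : M}
    (hx : x ∉ singularSet I F) {T : Type*} [TopologicalSpace T] [PreconnectedSpace T]
    {a b : T → ℝ} (ha : Continuous a) (hb : Continuous b) (haD : ∀ t, (x, a t) ∈ D)
    (hab : ∀ t, Φ x (a t) = Φ x (b t)) {t₀ : T} (h0 : a t₀ = b t₀) (t : T) : a t = b t := by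
  have hopen : IsOpen {t | a t = b t} := by
    refine isOpen_iff_mem_nhds.2 fun s hs => ?_
    obtain ⟨B, hB, hinj⟩ := h.eventually_injective (haD s) hx
    have hs' : a s = b s := hs
    filter_upwards [ha.continuousAt.eventually_mem hB,
      hb.continuousAt.eventually_mem (by rw [← hs']; exact hB)] with r h1 h2
    exact hinj h1 h2 (hab r)
  have := IsClopen.eq_univ ⟨isClosed_eq ha hb, hopen⟩ ⟨t₀, h0⟩
  exact this.ge (mem_univ t)

/-- Existence of continuous lifts of a path in an orbit to flow time. -/
lemma IsLocalFlow.exists_lift [IsManifold I ∞ M] [TopologicalSpace.MetrizableSpace M] (h : IsLocalFlow I F D Φ)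
    {x : M} (hx : x ∉ singularSet I F) {γ : ℝ → M} (hγ : Continuous γ)
    (hγx : ∀ t, γ t ∈ orbit D Φ x) (h0 : γ 0 = x) (b : ℝ) :
    ∃ a : ℝ → ℝ, ContinuousOn a (Icc 0 b) ∧ a 0 = 0 ∧
      ∀ t ∈ Icc 0 b, (x, a t) ∈ D ∧ Φ x (a t) = γ t := by
  set P : ℝ → Prop := fun b => ∃ a : ℝ → ℝ, ContinuousOn a (Icc 0 b) ∧ a 0 = 0 ∧
      ∀ t ∈ Icc 0 b, (x, a t) ∈ D ∧ Φ x (a t) = γ t with hP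
  have hmono : ∀ s t, t ≤ s → P s → P t := fun s t hts ⟨a, h1, h2, h3⟩ =>
    ⟨a, h1.mono (Icc_subset_Icc_right hts), h2, fun r hr => h3 r (Icc_subset_Icc_right hts hr)⟩
  have hP0 : P 0 := by
    refine ⟨fun _ => 0, continuousOn_const, rfl, fun t ht => ?_⟩
    have : t = 0 := le_antisymm ht.2 ht.1
    rw [this, h0]
    exact ⟨h.zero_mem x, h.map_zero x⟩
  -- `P` is locally constant, so the set where it holds is clopen. Only passing to a larger time
  -- needs a flow box; for times at most 0 it follows from `P 0`.
  have hstep : ∀ t₀, ∃ J ∈ 𝓝 t₀, ∀ s ∈ J, ∀ t ∈ J, P s → P t := by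
    intro t₀
    obtain ⟨U, τ, hp, hU⟩ := h.exists_isFlowBox (h.nonsingular_of_mem_orbit hx (hγx t₀))
    obtain ⟨ε, hε, hball⟩ := Metric.mem_nhds_iff.1
      (hγ.continuousAt.preimage_mem_nhds (hU.isOpen.mem_nhds hp))
    have hconv : Convex ℝ (Metric.ball t₀ ε) := convex_ball _ _
    have : PreconnectedSpace (Metric.ball t₀ ε) :=
      isPreconnected_iff_preconnectedSpace.1 hconv.isPreconnected
    have key : ∀ s ∈ Metric.ball t₀ ε, ∀ t ∈ Metric.ball t₀ ε, 0 ≤ s → s ≤ t → P s → P t := by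
      rintro s hs t ht hs0 hst ⟨a, h1, h2, h3⟩
      have hsub : ∀ r ∈ Icc s t, r ∈ Metric.ball t₀ ε := fun r hr =>
        hconv.ordConnected.out hs ht hr
      -- The old lift up to `s`, continued by the change of `τ`; `min` and `max` glue the two pieces
      -- continuously.
      refine ⟨fun r => a (min r s) + (τ (γ s) - τ (γ (max r s))), ?_, ?_, fun r hr => ?_⟩
      · refine ContinuousOn.add (h1.comp (by fun_prop) fun r hr =>
          ⟨le_min hr.1 hs0, min_le_right _ _⟩) (continuousOn_const.sub ?_)
        exact hU.contMDiffOn.continuousOn.comp (by fun_prop) fun r hr =>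
          hball (hsub _ ⟨le_max_right _ _, max_le hr.2 hst⟩)
      · simp [h2, hs0]
      · rcases le_total r s with hrs | hrs
        · simpa [hrs] using h3 r ⟨hr.1, hrs⟩
        · simp only [min_eq_right hrs, max_eq_left hrs]
          obtain ⟨h4, h5⟩ := h3 s ⟨hs0, le_rfl⟩
          exact hU.map_path h (γ := fun r : Metric.ball t₀ ε => γ r)
            (hγ.comp continuous_subtype_val) (fun r => hball r.2) (fun r => hγx r)
            (s := ⟨s, hs⟩) h4 h5 ⟨r, hsub r ⟨hrs, hr.2⟩⟩
    refine ⟨Metric.ball t₀ ε, Metric.ball_mem_nhds _ hε, fun s hs t ht hPs => ?_⟩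
    rcases le_total t 0 with ht0 | ht0
    · exact hmono 0 t ht0 hP0
    rcases le_total t s with hts | hst
    · exact hmono s t hts hPs
    rcases le_total s 0 with hs0 | hs0
    · exact key 0 (hconv.ordConnected.out hs ht ⟨hs0, ht0⟩) t ht le_rfl ht0 hP0
    · exact key s hs t ht hs0 hst hPs
  have hclopen : IsClopen {t | P t} := by
    refine ⟨isOpen_compl_iff.1 (isOpen_iff_mem_nhds.2 fun t₀ ht₀ => ?_),
      isOpen_iff_mem_nhds.2 fun t₀ ht₀ => ?_⟩ <;> obtain ⟨J, hJ, hJP⟩ := hstep t₀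
    · filter_upwards [hJ] with t ht hPt using ht₀ (hJP t ht t₀ (mem_of_mem_nhds hJ) hPt)
    · filter_upwards [hJ] with t ht using hJP t₀ (mem_of_mem_nhds hJ) t ht ht₀
  have hall := hclopen.eq_univ ⟨0, hP0⟩
  exact hall.ge (mem_univ b)

end Lifting

/-! ### Lifting a family of orbit-preserving maps -/

section FamilyLift

variable {E : Type*} [NormedAddCommGroup E] [NormedSpace ℝ E] {H : Type*} [TopologicalSpace H]
  {I : ModelWithCorners ℝ E H} {M : Type*} [TopologicalSpace M] [ChartedSpace H M]
  {F : (x : M) → TangentSpace I x} {D : Set (M × ℝ)} {Φ : M → ℝ → M}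

/-- A flow box contains no singular point, because `τ` changes at unit speed along the flow. -/
lemma IsLocalFlow.isClosed_singularSet [IsManifold I ∞ M] (h : IsLocalFlow I F D Φ) :
    IsClosed (singularSet I F) := by
  refine isOpen_compl_iff.1 (isOpen_iff_mem_nhds.2 fun p hp => ?_)
  obtain ⟨U, τ, hpU, hU⟩ := h.exists_isFlowBox hp
  filter_upwards [hU.isOpen.mem_nhds hpU] with x hx hx0
  have h1 : ∀ᶠ s in 𝓝 (0 : ℝ), s = 0 := by
    filter_upwards [hU.map_flow x hx] with s hs
    rw [(h.of_singular hx0 s).2] at hs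
    linarith
  obtain ⟨ε, hε, hball⟩ := Metric.eventually_nhds_iff.1 h1
  have := hball (y := ε / 2) (by
    rw [Real.dist_eq, sub_zero, abs_of_pos (half_pos hε)]; exact half_lt_self hε)
  linarith

/-- A continuous family of smooth maps which preserve the orbits, starting from the inclusion,
consists of shifts along the orbits by functions which are smooth away from the singular points and
locally expressed through flow box coordinates. -/
theorem IsLocalFlow.exists_family_lift [IsManifold I ∞ M] [TopologicalSpace.MetrizableSpace M]
    (h : IsLocalFlow I F D Φ) {W : TopologicalSpace.Opens M} {p : ℝ → C^∞⟮I, W; I, M⟯}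
    (hp : Continuous fun q : ℝ × W => p q.1 q.2) (hp0 : ∀ x : W, p 0 x = x)
    (horb : ∀ t (x : W), p t x ∈ orbit D Φ (x : M))
    (hproj : ∀ t, p t = p (projIcc (0 : ℝ) 1 zero_le_one t)) :
    ∃ α : ℝ → W → ℝ, (∀ x, α 0 x = 0) ∧
      (∀ t (x : W), ((x : M), α t x) ∈ D ∧ Φ x (α t x) = p t x) ∧
      (∀ t (x : W), (x : M) ∉ singularSet I F → ContMDiffAt I 𝓘(ℝ, ℝ) ∞ (α t) x) ∧
      ∀ t₀ (x₀ : W), (x₀ : M) ∉ singularSet I F → ∃ U τ, IsFlowBox I D Φ U τ ∧ p t₀ x₀ ∈ U ∧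
        ∀ᶠ q in 𝓝 (t₀, x₀), p q.1 q.2 ∈ U ∧
          α q.1 q.2 = α t₀ q.2 + (τ (p t₀ q.2) - τ (p q.1 q.2)) := by
  have hlift : ∀ x : W, ∃ a : ℝ → ℝ, Continuous a ∧ a 0 = 0 ∧
      ∀ t, ((x : M), a t) ∈ D ∧ Φ x (a t) = p t x := by
    intro x
    by_cases hx : (x : M) ∈ singularSet I F
    · refine ⟨fun _ => 0, continuous_const, rfl, fun t => ⟨h.zero_mem _, ?_⟩⟩
      rw [h.map_zero, h.orbit_of_singular hx (horb t x)]
    · obtain ⟨a, h1, h2, h3⟩ := h.exists_lift hx (γ := fun t => p t x)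
        (hp.comp (Continuous.prodMk_left x)) (fun t => horb t x) (hp0 x) 1
      -- A lift over `[0, 1]` suffices, as the path is constant beyond the endpoints.
      refine ⟨fun t => a (projIcc (0 : ℝ) 1 zero_le_one t), ?_, ?_, fun t => ?_⟩
      · exact h1.comp_continuous (continuous_subtype_val.comp continuous_projIcc)
          fun t => (projIcc (0 : ℝ) 1 zero_le_one t).2
      · simpa [projIcc] using h2
      · rw [hproj t]
        exact h3 _ (projIcc (0 : ℝ) 1 zero_le_one t).2
  choose a hac ha0 haΦ using hlift
  have hloc : ∀ t₀ (x₀ : W), (x₀ : M) ∉ singularSet I F → ∃ U τ, IsFlowBox I D Φ U τ ∧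
      p t₀ x₀ ∈ U ∧ ∀ᶠ q in 𝓝 (t₀, x₀), p q.1 q.2 ∈ U ∧
        a q.2 q.1 = a q.2 t₀ + (τ (p t₀ q.2) - τ (p q.1 q.2)) := by
    intro t₀ x₀ hx₀
    obtain ⟨U, τ, hpU, hU⟩ := h.exists_isFlowBox (h.nonsingular_of_mem_orbit hx₀ (horb t₀ x₀))
    refine ⟨U, τ, hU, hpU, ?_⟩
    have hval : ContinuousAt (fun q : ℝ × W => (q.2 : M)) (t₀, x₀) :=
      (continuous_subtype_val.comp continuous_snd).continuousAt
    have hev : ∀ᶠ q : ℝ × W in 𝓝 (t₀, x₀), p q.1 q.2 ∈ U ∧ (q.2 : M) ∉ singularSet I F :=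
      (hp.continuousAt.eventually_mem (hU.isOpen.mem_nhds hpU)).and
        (hval.eventually_mem
          (h.isClosed_singularSet.isOpen_compl.mem_nhds hx₀))
    rw [nhds_prod_eq] at hev ⊢
    obtain ⟨A, hA, B, hB, hAB⟩ := eventually_prod_iff.1 hev
    obtain ⟨ε, hε, hball⟩ := Metric.mem_nhds_iff.1 hA
    have hpre : PreconnectedSpace (Metric.ball t₀ ε) :=
      isPreconnected_iff_preconnectedSpace.1 (convex_ball _ _).isPreconnected
    refine eventually_prod_iff.2 ⟨_, Metric.ball_mem_nhds t₀ hε, B, hB, fun {t} ht {x} hx => ?_⟩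
    have hx' : (x : M) ∉ singularSet I F := (hAB (hball ht) hx).2
    refine ⟨(hAB (hball ht) hx).1, ?_⟩
    have hUp : ∀ s : Metric.ball t₀ ε, p s x ∈ U := fun s => (hAB (hball s.2) hx).1
    have hγ : Continuous fun s : Metric.ball t₀ ε => p s x :=
      hp.comp (continuous_subtype_val.prodMk continuous_const)
    have hτ : Continuous fun s : Metric.ball t₀ ε => τ (p s x) :=
      hU.contMDiffOn.continuousOn.comp_continuous hγ hUp
    have hmap := hU.map_path h hγ hUp (fun s => horb s x)
      (s := ⟨t₀, Metric.mem_ball_self hε⟩) (haΦ x t₀).1 (haΦ x t₀).2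
    -- Both sides lift the same path over a connected interval of times and agree at `t₀`.
    exact h.lift_unique hx' (a := fun s : Metric.ball t₀ ε => a x s)
      (b := fun s => a x t₀ + (τ (p t₀ x) - τ (p s x)))
      ((hac x).comp continuous_subtype_val) (continuous_const.add (continuous_const.sub hτ))
      (fun s => (haΦ x s).1) (fun s => by rw [(haΦ x s).2]; exact (hmap s).2.symm)
      (t₀ := ⟨t₀, Metric.mem_ball_self hε⟩) (by simp) ⟨t, ht⟩
  refine ⟨fun t x => a x t, ha0, fun t x => haΦ x t, fun t x hx => ?_, hloc⟩
  -- For nearby times the lifts differ by a smooth difference of `τ`-values, so smoothness at `x` is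
  -- a clopen condition on time, and it holds at time 0.
  have hstep : ∀ t₀, ∀ᶠ t in 𝓝 t₀, (ContMDiffAt I 𝓘(ℝ, ℝ) ∞ (fun x => a x t) x ↔
      ContMDiffAt I 𝓘(ℝ, ℝ) ∞ (fun x => a x t₀) x) := by
    intro t₀
    obtain ⟨U, τ, hU, hpU, hev⟩ := hloc t₀ x hx
    filter_upwards [(Eventually.curry_nhds hev)] with t ht
    have hs : ∀ s, p s x ∈ U → ContMDiffAt I 𝓘(ℝ, ℝ) ∞ (fun y => τ (p s y)) x := fun s hs =>
      (hU.contMDiffOn.contMDiffAt (hU.isOpen.mem_nhds hs)).comp x ((p s).contMDiff x)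
    have hd := (hs t₀ hpU).sub (hs t ht.self_of_nhds.1)
    constructor
    · intro h1
      refine (h1.sub hd).congr_of_eventuallyEq ?_
      filter_upwards [ht] with y hy
      simp [hy.2]
    · intro h1
      refine (h1.add hd).congr_of_eventuallyEq ?_
      filter_upwards [ht] with y hy
      simp [hy.2]
  have hclopen : IsClopen {t | ContMDiffAt I 𝓘(ℝ, ℝ) ∞ (fun x => a x t) x} := by
    refine ⟨isOpen_compl_iff.1 (isOpen_iff_mem_nhds.2 fun t₀ ht₀ => ?_),
      isOpen_iff_mem_nhds.2 fun t₀ ht₀ => ?_⟩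
    · filter_upwards [hstep t₀] with t ht h1 using ht₀ (ht.1 h1)
    · filter_upwards [hstep t₀] with t ht using ht.2 ht₀
  have hzero : ContMDiffAt I 𝓘(ℝ, ℝ) ∞ (fun x => a x 0) x := by
    simp only [ha0]; exact contMDiffAt_const
  exact (hclopen.eq_univ ⟨0, hzero⟩).ge (mem_univ t)

end FamilyLift

/-! ### Local diffeomorphisms and smaller open sets -/

section LocalDiffeo

variable {E : Type*} [NormedAddCommGroup E] [NormedSpace ℝ E] {H : Type*} [TopologicalSpace H]
  {I : ModelWithCorners ℝ E H} {M : Type*} [TopologicalSpace M] [ChartedSpace H M]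
  {E' : Type*} [NormedAddCommGroup E'] [NormedSpace ℝ E'] {H' : Type*} [TopologicalSpace H']
  {J : ModelWithCorners ℝ E' H'} {N : Type*} [TopologicalSpace N] [ChartedSpace H' N]

lemma isLocalDiffeomorphAt_congr {f g : M → N} {x : M}
    (hf : IsLocalDiffeomorphAt I J ∞ f x) (hfg : g =ᶠ[𝓝 x] f) :
    IsLocalDiffeomorphAt I J ∞ g x := by
  obtain ⟨Ψ, hx, hΨ⟩ := hf
  obtain ⟨O, hO, hOo, hxO⟩ := eventually_nhds_iff.1 hfg
  set e := Ψ.toOpenPartialHomeomorph.restrOpen O hOo with he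
  refine ⟨{ toPartialEquiv := e.toPartialEquiv
            open_source := e.open_source
            open_target := e.open_target
            contMDiffOn_toFun := Ψ.contMDiffOn_toFun.mono fun y hy => hy.1
            contMDiffOn_invFun := Ψ.contMDiffOn_invFun.mono fun y hy => hy.1 },
    ⟨hx, hxO⟩, fun y hy => ?_⟩
  exact (hO y hy.2).trans (hΨ hy.1)

variable {V W : TopologicalSpace.Opens M}

open Classical in
/-- The partial inverse `V → W` of the inclusion `W ⊆ V`; points outside `W` go to a fixed point. -/
noncomputable def retract (V : TopologicalSpace.Opens M) (w : W) : V → W := fun x =>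
  if hx : (x : M) ∈ W then ⟨x, hx⟩ else w

lemma retract_of_mem (w : W) {x : V} (hx : (x : M) ∈ W) : retract V w x = ⟨x, hx⟩ := dif_pos hx

lemma contMDiffAt_retract (w : W) {x : V} (hx : (x : M) ∈ W) :
    ContMDiffAt I I ∞ (retract V w) x := by
  rw [← ContMDiffAt.subtypeVal_comp_iff]
  refine (contMDiff_subtype_val (I := I)).contMDiffAt.congr_of_eventuallyEq ?_
  filter_upwards [(W.isOpen.preimage continuous_subtype_val).mem_nhds hx] with y hy
  simp [retract_of_mem w hy]

/-- The inclusion `W ⊆ V` as a partial diffeomorphism, with inverse `retract`. -/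
noncomputable def inclusionPartialDiffeomorph (I : ModelWithCorners ℝ E H) (hWV : W ≤ V) (w : W) :
    PartialDiffeomorph I I W V ∞ where
  toFun := TopologicalSpace.Opens.inclusion hWV
  invFun := retract V w
  source := univ
  target := {x | (x : M) ∈ W}
  map_source' x _ := x.2
  map_target' _ _ := mem_univ _
  left_inv' x _ := retract_of_mem w (x := TopologicalSpace.Opens.inclusion hWV x) x.2
  right_inv' x hx := by rw [retract_of_mem w hx]; rfl
  open_source := isOpen_univ
  open_target := W.isOpen.preimage continuous_subtype_val
  contMDiffOn_toFun := (contMDiff_inclusion hWV).contMDiffOn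
  contMDiffOn_invFun _ hx := (contMDiffAt_retract w hx).contMDiffWithinAt

/-- Being a local diffeomorphism at a point does not depend on the open set of definition. -/
lemma isLocalDiffeomorphAt_inclusion_iff (hWV : W ≤ V) {f : V → N} {g : W → N} {z : W}
    (hfg : ∀ᶠ x : W in 𝓝 z, g x = f (TopologicalSpace.Opens.inclusion hWV x)) :
    IsLocalDiffeomorphAt I J ∞ g z ↔
      IsLocalDiffeomorphAt I J ∞ f (TopologicalSpace.Opens.inclusion hWV z) := by
  set e := inclusionPartialDiffeomorph I hWV z with he
  constructor
  · intro hg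
    have hr : retract V z (TopologicalSpace.Opens.inclusion hWV z) = z :=
      e.left_inv' (mem_univ z)
    have h1 : IsLocalDiffeomorphAt I I ∞ (retract V z) (TopologicalSpace.Opens.inclusion hWV z) :=
      ⟨e.symm, e.map_source' (mem_univ z), eqOn_refl _ _⟩
    have h2 := h1.comp J N (g := g) (by rw [hr]; exact hg)
    refine isLocalDiffeomorphAt_congr h2 ?_
    have htend : Tendsto (retract V z) (𝓝 (TopologicalSpace.Opens.inclusion hWV z)) (𝓝 z) := by
      have := (contMDiffAt_retract (I := I) z
        (x := TopologicalSpace.Opens.inclusion hWV z) z.2).continuousAt.tendsto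
      rwa [hr] at this
    filter_upwards [htend.eventually hfg, (W.isOpen.preimage continuous_subtype_val).mem_nhds
      (show ((TopologicalSpace.Opens.inclusion hWV z : V) : M) ∈ W from z.2)] with x hx hxW
    rw [Function.comp, hx]
    congr 1
    exact (e.right_inv' hxW).symm
  · intro hf
    have h1 : IsLocalDiffeomorphAt I I ∞ (TopologicalSpace.Opens.inclusion hWV) z :=
      ⟨e, mem_univ z, eqOn_refl _ _⟩
    exact isLocalDiffeomorphAt_congr (h1.comp J N hf) hfg

end LocalDiffeo

/-! ### Further families between manifolds -/

section MoreFamilies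

variable {T : Type*} [TopologicalSpace T]
  {E : Type*} [NormedAddCommGroup E] [NormedSpace ℝ E] {H : Type*} [TopologicalSpace H]
  {I : ModelWithCorners ℝ E H} {N : Type*} [TopologicalSpace N]
  {E' : Type*} [NormedAddCommGroup E'] [NormedSpace ℝ E'] {H' : Type*} [TopologicalSpace H']
  {J : ModelWithCorners ℝ E' H'} {N' : Type*} [TopologicalSpace N']
  {l : ℕ} {φ : OpenPartialHomeomorph N H} {ψ : OpenPartialHomeomorph N' H'} {t₀ : T} {x₀ : N}

lemma MFamilyAt.congr {g g' : T → N → N'} (hg : MFamilyAt I J l φ ψ g t₀ x₀)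
    (hgg' : ∀ᶠ q in 𝓝 (t₀, x₀), g' q.1 q.2 = g q.1 q.2) (hx : x₀ ∈ φ.source) :
    MFamilyAt I J l φ ψ g' t₀ x₀ := by
  refine ⟨hg.1.congr (hgg'.mono fun q hq => hq.symm), hg.2.congr ?_ (extend_mem_range φ x₀)⟩
  filter_upwards [(tendsto_prod_extend_symm hx t₀).eventually hgg'] with q hq
  simp only [chartRep, hq]

variable [ChartedSpace H N] [ChartedSpace H' N']

lemma MFamilyAt.const {f : N → N'} (hφ : φ ∈ IsManifold.maximalAtlas I ∞ N)
    (hψ : ψ ∈ IsManifold.maximalAtlas J ∞ N') (hf : ContMDiffAt I J ∞ f x₀) (hx : x₀ ∈ φ.source)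
    (hy : f x₀ ∈ ψ.source) : MFamilyAt I J l φ ψ (fun _ : T => f) t₀ x₀ :=
  ⟨hf.continuousAt.comp_of_eq continuousAt_snd rfl,
    .const (((contMDiffAt_iff_of_mem_maximalAtlas hφ hψ hx hy).1 hf).2.of_le
      (by exact_mod_cast le_top)) I.uniqueDiffOn (extend_mem_range φ x₀)⟩

lemma MFamilyAt.mul_const {f : N → ℝ} {c : T → ℝ} (hφ : φ ∈ IsManifold.maximalAtlas I ∞ N)
    (hc : ContinuousAt c t₀) (hf : ContMDiffAt I 𝓘(ℝ, ℝ) ∞ f x₀) (hx : x₀ ∈ φ.source) :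
    MFamilyAt I 𝓘(ℝ, ℝ) l φ (OpenPartialHomeomorph.refl ℝ) (fun t x => c t * f x) t₀ x₀ := by
  refine ⟨(hc.comp_of_eq continuousAt_fst rfl).mul
    (hf.continuousAt.comp_of_eq continuousAt_snd rfl), ?_⟩
  have hrefl : OpenPartialHomeomorph.refl ℝ ∈ IsManifold.maximalAtlas 𝓘(ℝ, ℝ) ∞ ℝ :=
    StructureGroupoid.id_mem_maximalAtlas _
  exact FamilyAt.smul_const (f := chartRep I 𝓘(ℝ, ℝ) φ (OpenPartialHomeomorph.refl ℝ) f) hc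
    (((contMDiffAt_iff_of_mem_maximalAtlas hφ hrefl hx (mem_univ _)).1 hf).2.of_le
      (by exact_mod_cast le_top)) I.uniqueDiffOn (extend_mem_range φ x₀)

end MoreFamilies

/-! ### The two inclusions -/

section Main

variable {E : Type*} [NormedAddCommGroup E] [NormedSpace ℝ E] {H : Type*} [TopologicalSpace H]
  {I : ModelWithCorners ℝ E H} {M : Type*} [TopologicalSpace M] [ChartedSpace H M]
  {F : (x : M) → TangentSpace I x} {D : Set (M × ℝ)} {Φ : M → ℝ → M}
  {V W : TopologicalSpace.Opens M} {k : ℕ∞}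

lemma endoId_subset : endoId I F D Φ V k ⊆ endo I F D Φ V := by
  let := weakTopology I V I M k
  exact pathComponentIn_subset

lemma mem_endoId_of_path {h : C^∞⟮I, V; I, M⟯} {q : ℝ → C^∞⟮I, V; I, M⟯}
    (hq : letI := weakTopology I V I M k; Continuous q) (h0 : q 0 = inclusion I V) (h1 : q 1 = h)
    (hmem : ∀ t ∈ Icc (0 : ℝ) 1, q t ∈ endo I F D Φ V) : h ∈ endoId I F D Φ V k := by
  let := weakTopology I V I M k
  exact JoinedIn.ofLine (Continuous.continuousOn hq) h0 h1 (image_subset_iff.2 hmem)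

lemma exists_path_of_mem_endoId {h : C^∞⟮I, V; I, M⟯} (hh : h ∈ endoId I F D Φ V k) :
    ∃ q : ℝ → C^∞⟮I, V; I, M⟯, (letI := weakTopology I V I M k; Continuous q) ∧
      q 0 = inclusion I V ∧ q 1 = h ∧ (∀ t, q t ∈ endo I F D Φ V) ∧
      ∀ t, q t = q (projIcc (0 : ℝ) 1 zero_le_one t) := by
  let := weakTopology I V I M k
  obtain ⟨γ, hγ⟩ : JoinedIn (endo I F D Φ V) (inclusion I V) h := hh
  refine ⟨γ.extend, γ.continuous_extend, γ.extend_zero, γ.extend_one, fun t => hγ _, fun t => ?_⟩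
  simp [Path.extend, IccExtend]

lemma IsLocalFlow.contMDiffAt_shift {E' : Type*} [NormedAddCommGroup E'] [NormedSpace ℝ E']
    {H' : Type*} [TopologicalSpace H'] {J : ModelWithCorners ℝ E' H'} {N : Type*}
    [TopologicalSpace N] [ChartedSpace H' N] (h : IsLocalFlow I F D Φ) {f : N → M} {β : N → ℝ}
    {x : N} (hf : ContMDiffAt J I ∞ f x) (hβ : ContMDiffAt J 𝓘(ℝ, ℝ) ∞ β x)
    (hx : (f x, β x) ∈ D) : ContMDiffAt J I ∞ (fun y => Φ (f y) (β y)) x :=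
  ContMDiffAt.comp (g := fun q : M × ℝ => Φ q.1 q.2) x
    (h.contMDiffOn.contMDiffAt (h.isOpen_domain.mem_nhds hx)) (hf.prodMk hβ)

/-- A smooth cutoff function on `V`, supported in `W` and equal to `1` near the singular points of
`W`. -/
lemma exists_cutoff [FiniteDimensional ℝ E] [IsManifold I ∞ M] [T2Space M]
    [SecondCountableTopology M] (hΦ : IsLocalFlow I F D Φ)
    (hWsing : IsClosed {z : ↥((V : Set M) ∩ singularSet I F) | (z : M) ∈ W}) :
    ∃ χ : C^∞⟮I, V; 𝓘(ℝ, ℝ), ℝ⟯, (∀ x : V, (x : M) ∉ W → ∀ᶠ y in 𝓝 x, χ y = 0) ∧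
      (∀ x : V, (x : M) ∈ W → (x : M) ∈ singularSet I F → ∀ᶠ y in 𝓝 x, χ y = 1) ∧
      ∀ x, χ x ∈ Icc (0 : ℝ) 1 := by
  have : LocallyCompactSpace M := Manifold.locallyCompact_of_finiteDimensional I
  have : LocallyCompactSpace V := V.isOpen.locallyCompactSpace
  have : TopologicalSpace.MetrizableSpace M := Manifold.metrizableSpace I M
  obtain ⟨C, hC, hCW⟩ := isClosed_induced_iff.1 hWsing
  -- Closedness in V ∩ Σ becomes closedness in V since Σ is closed; this is what separates W ∩ Σ
  -- from V ∖ W.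
  have hA : IsClosed {x : V | (x : M) ∈ W ∧ (x : M) ∈ singularSet I F} := by
    have : {x : V | (x : M) ∈ W ∧ (x : M) ∈ singularSet I F} =
        Subtype.val ⁻¹' (C ∩ singularSet I F) := by
      ext x
      refine and_congr_left fun hx => ?_
      have := Set.ext_iff.1 hCW ⟨x, x.2, hx⟩
      exact this.symm
    rw [this]
    exact (hC.inter hΦ.isClosed_singularSet).preimage continuous_subtype_val
  have hB : IsClosed {x : V | (x : M) ∉ W} :=
    W.isOpen.isClosed_compl.preimage continuous_subtype_val
  obtain ⟨χ, h0, h1, h01⟩ := exists_contMDiffMap_zero_one_nhds_of_isClosed I (n := ⊤) hB hA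
    (disjoint_left.2 fun x hx hx' => hx hx'.1)
  exact ⟨χ, fun x hx => h0.filter_mono (nhds_le_nhdsSet hx),
    fun x hx hx' => h1.filter_mono (nhds_le_nhdsSet
      (show x ∈ {x : V | (x : M) ∈ W ∧ (x : M) ∈ singularSet I F} from ⟨hx, hx'⟩)), h01⟩

/-- Shifts along the orbits lie in `endo` over a smaller open set `W ⊆ V`, if they do over `V`. -/
lemma mem_endo_of_shift [FiniteDimensional ℝ E] [IsManifold I ∞ M] [T2Space M]
    [SecondCountableTopology M] (hΦ : IsLocalFlow I F D Φ)
    (hVk : shiftImage I D Φ V ⊆ endo I F D Φ V) (hWV : W ≤ V)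
    (hWsing : IsClosed {z : ↥((V : Set M) ∩ singularSet I F) | (z : M) ∈ W})
    {h : C^∞⟮I, W; I, M⟯} (hh : h ∈ shiftImage I D Φ W) : h ∈ endo I F D Φ W := by
  obtain ⟨α, hα, hαh⟩ := hh
  refine ⟨fun x y hy => ?_, fun z hz => ?_⟩
  · rw [hαh y]
    exact hΦ.mem_orbit_trans hy ⟨α y, hα y, rfl⟩
  obtain ⟨χ, h0, h1, h01⟩ := exists_cutoff hΦ hWsing
  have hχ : ∀ x : V, (x : M) ∉ W → χ x = 0 := fun x hx => (h0 x hx).self_of_nhds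
  -- The extension of `χ α` by zero: outside `W` the arbitrary value of `retract` is multiplied by
  -- zero. The resulting shift of `V` equals `h` near `z` and is a local diffeomorphism there by
  -- `hVk`.
  have hβ : ContMDiff I 𝓘(ℝ, ℝ) ∞ fun x : V => χ x * α (retract V z x) := by
    intro x
    by_cases hx : (x : M) ∈ W
    · exact (χ.contMDiff x).mul ((α.contMDiff _).comp x (contMDiffAt_retract z hx))
    · refine (contMDiffAt_const (c := (0 : ℝ))).congr_of_eventuallyEq ?_
      filter_upwards [h0 x hx] with y hy
      rw [hy, zero_mul]
  have hβD : ∀ x : V, ((x : M), χ x * α (retract V z x)) ∈ D := by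
    intro x
    by_cases hx : (x : M) ∈ W
    · refine hΦ.smul_mem ?_ (h01 x).1 (h01 x).2
      rw [retract_of_mem z hx]
      exact hα ⟨x, hx⟩
    · rw [hχ x hx, zero_mul]
      exact hΦ.zero_mem _
  set g : C^∞⟮I, V; I, M⟯ := ⟨fun x : V => Φ x (χ x * α (retract V z x)), fun x =>
    hΦ.contMDiffAt_shift contMDiff_subtype_val.contMDiffAt (hβ x) (hβD x)⟩ with hg
  have hgE : g ∈ endo I F D Φ V := hVk ⟨⟨_, hβ⟩, hβD, fun x => rfl⟩
  refine (isLocalDiffeomorphAt_inclusion_iff hWV ?_).2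
    (hgE.2 (TopologicalSpace.Opens.inclusion hWV z) hz)
  have hc : Tendsto (TopologicalSpace.Opens.inclusion hWV) (𝓝 z)
      (𝓝 (TopologicalSpace.Opens.inclusion hWV z)) :=
    (contMDiff_inclusion (I := I) (n := ∞) hWV).continuous.continuousAt
  filter_upwards [hc.eventually (h1 (TopologicalSpace.Opens.inclusion hWV z) z.2 hz)] with x hx
  change h x = Φ x (χ (TopologicalSpace.Opens.inclusion hWV x) *
    α (retract V z (TopologicalSpace.Opens.inclusion hWV x)))
  rw [hx, one_mul, hαh x, retract_of_mem z (x := TopologicalSpace.Opens.inclusion hWV x) x.2]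

/-- The path is the shift by `t α`, with `t` clamped to `[0, 1]`; each stage is again a shift, so
`hW` applies to it. -/
lemma shiftImage_subset_endoId [IsManifold I ∞ M] (hΦ : IsLocalFlow I F D Φ)
    (hW : shiftImage I D Φ W ⊆ endo I F D Φ W) :
    shiftImage I D Φ W ⊆ endoId I F D Φ W k := by
  rintro h ⟨α, hα, hαh⟩
  have hD : ∀ t ∈ Icc (0 : ℝ) 1, ∀ x : W, ((x : M), t * α x) ∈ D := fun t ht x =>
    hΦ.smul_mem (hα x) ht.1 ht.2
  set c : ℝ → ℝ := fun t => projIcc (0 : ℝ) 1 zero_le_one t with hc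
  have hcc : Continuous c := continuous_subtype_val.comp continuous_projIcc
  have hcI : ∀ t, c t ∈ Icc (0 : ℝ) 1 := fun t => (projIcc (0 : ℝ) 1 zero_le_one t).2
  have hcα : ∀ t, ContMDiff I 𝓘(ℝ, ℝ) ∞ fun x : W => c t * α x := fun t =>
    contMDiff_const.mul α.contMDiff
  set q : ℝ → C^∞⟮I, W; I, M⟯ := fun t => ⟨fun x => Φ x (c t * α x), fun x =>
    hΦ.contMDiffAt_shift contMDiff_subtype_val.contMDiffAt (hcα t x) (hD _ (hcI t) x)⟩ with hq
  refine mem_endoId_of_path (q := q) (continuous_weakTopology ?_) ?_ ?_ fun t ht =>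
    hW ⟨⟨_, hcα t⟩, hD _ (hcI t), fun x => rfl⟩
  · intro l hl t₀ x₀ φ hφ ψ hψ hx hy
    have hrefl : OpenPartialHomeomorph.refl ℝ ∈ IsManifold.maximalAtlas 𝓘(ℝ, ℝ) ∞ ℝ :=
      StructureGroupoid.id_mem_maximalAtlas _
    exact MFamilyAt.comp (l := l) (j := id) (Q := fun p : W × ℝ => Φ p.1 p.2) hφ hrefl hφ hψ
      (MFamilyAt.mul_const hφ hcc.continuousAt (α.contMDiff x₀) hx) contMDiffAt_id
      (hΦ.contMDiffAt_shift (contMDiff_subtype_val.contMDiffAt.comp _ contMDiffAt_fst)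
        contMDiffAt_snd (hD _ (hcI t₀) x₀)) hx (mem_univ _) hx hy
  · ext x
    change Φ x (c 0 * α x) = x
    simp [hc, projIcc, hΦ.map_zero]
  · ext x
    change Φ x (c 1 * α x) = h x
    simp [hc, projIcc, hαh x]

open Classical in
/-- The shift of the points of `V` along the orbits by the function `χ α`, which is understood to
vanish outside `W`. -/
noncomputable def cutoffShift (Φ : M → ℝ → M) (χ : V → ℝ) (α : W → ℝ) : V → M := fun x =>
  if hx : (x : M) ∈ W then Φ x (χ x * α ⟨x, hx⟩) else x

lemma cutoffShift_of_mem {χ : V → ℝ} {α : W → ℝ} {x : V} (hx : (x : M) ∈ W) (w : W) :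
    cutoffShift Φ χ α x = Φ x (χ x * α (retract V w x)) := by
  rw [cutoffShift, dif_pos hx, retract_of_mem w hx]

lemma cutoffShift_of_zero (hΦ : IsLocalFlow I F D Φ) {χ : V → ℝ} {α : W → ℝ} {x : V}
    (hx : χ x = 0) : cutoffShift Φ χ α x = x := by
  rw [cutoffShift]
  split_ifs
  · rw [hx, zero_mul, hΦ.map_zero]
  · rfl

/-- If every element of `endoId` over `V` is a shift along the orbits, then so is every element of
`endoId` over a smaller open set `W`, whose singular points form a closed set of singular points
of `V`. -/
theorem endoId_subset_shiftImage [FiniteDimensional ℝ E] [IsManifold I ∞ M] [T2Space M]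
    [SecondCountableTopology M] (hΦ : IsLocalFlow I F D Φ)
    (hV : endoId I F D Φ V k ⊆ shiftImage I D Φ V)
    (hVid : inclusion I V ∈ endo I F D Φ V) (hWV : W ≤ V) (hWne : (W : Set M).Nonempty)
    (hWsing : IsClosed {z : ↥((V : Set M) ∩ singularSet I F) | (z : M) ∈ W}) :
    endoId I F D Φ W k ⊆ shiftImage I D Φ W := by
  intro h hh
  have : LocallyCompactSpace M := Manifold.locallyCompact_of_finiteDimensional I
  have : LocallyCompactSpace W := W.isOpen.locallyCompactSpace
  have : TopologicalSpace.MetrizableSpace M := Manifold.metrizableSpace I M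
  obtain ⟨x₁, hx₁⟩ := hWne
  set w : W := ⟨x₁, hx₁⟩
  obtain ⟨p, hpc, hp0, hp1, hpE, hproj⟩ := exists_path_of_mem_endoId hh
  have hfam : ∀ l : ℕ, (l : ℕ∞) ≤ k → ∀ t₀ (x₀ : W), MFamilyAt I I l (chartAt H x₀)
      (chartAt H (p t₀ x₀)) (fun t => p t) t₀ x₀ := fun l hl t₀ x₀ =>
    mfamilyAt_of_continuous hpc hl (IsManifold.chart_mem_maximalAtlas _)
      (IsManifold.chart_mem_maximalAtlas _) (mem_chart_source _ _) (mem_chart_source _ _)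
  have hpcont : Continuous fun q : ℝ × W => p q.1 q.2 :=
    continuous_iff_continuousAt.2 fun q => (hfam 0 (by simp) q.1 q.2).1
  have horb : ∀ t (x : W), p t x ∈ orbit D Φ (x : M) := fun t x =>
    (hpE t).1 x x (hΦ.mem_orbit_self _)
  obtain ⟨α, hα0, hαΦ, hαs, hαloc⟩ := hΦ.exists_family_lift hpcont
    (fun x => by rw [hp0]; rfl) horb hproj
  obtain ⟨χ, h0, h1, h01⟩ := exists_cutoff hΦ hWsing
  have hopenW : ∀ x : V, (x : M) ∈ W → ∀ᶠ y : V in 𝓝 x, (y : M) ∈ W := fun x hx =>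
    (W.isOpen.preimage continuous_subtype_val).mem_nhds hx
  have hmem : ∀ t (x : V), (x : M) ∈ W → ((x : M), χ x * α t (retract V w x)) ∈ D := by
    intro t x hx
    refine hΦ.smul_mem ?_ (h01 x).1 (h01 x).2
    rw [retract_of_mem w hx]
    exact (hαΦ t ⟨x, hx⟩).1
  have hout : ∀ x : V, (x : M) ∉ W → ∀ᶠ y in 𝓝 x, ∀ t, cutoffShift Φ χ (α t) y = y := by
    intro x hx
    filter_upwards [h0 x hx] with y hy t using cutoffShift_of_zero hΦ hy
  -- Since `χ = 1` here, the new family coincides with `p` and is regular even where `α t` is not;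
  -- one neighbourhood serves all `t`.
  have hsing : ∀ x : V, (x : M) ∈ W → (x : M) ∈ singularSet I F → ∀ᶠ y in 𝓝 x, ∀ t,
      cutoffShift Φ χ (α t) y = p t (retract V w y) := by
    intro x hx hxs
    filter_upwards [h1 x hx hxs, hopenW x hx] with y hy hyW t
    rw [cutoffShift_of_mem hyW w, hy, one_mul, ← (hαΦ t _).2, retract_of_mem w hyW]
  have hsmooth : ∀ t, ContMDiff I I ∞ (cutoffShift Φ χ (α t)) := by
    intro t x
    by_cases hx : (x : M) ∈ W
    · by_cases hxs : (x : M) ∈ singularSet I F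
      · refine (((p t).contMDiff _).comp x (contMDiffAt_retract w hx)).congr_of_eventuallyEq ?_
        filter_upwards [hsing x hx hxs] with y hy using hy t
      · have hr : ((retract V w x : W) : M) ∉ singularSet I F := by rwa [retract_of_mem w hx]
        refine (hΦ.contMDiffAt_shift (f := fun y : V => (y : M))
          (β := fun y => χ y * α t (retract V w y)) contMDiff_subtype_val.contMDiffAt
          ((χ.contMDiff x).mul ((hαs t _ hr).comp x (contMDiffAt_retract w hx)))
          (hmem t x hx)).congr_of_eventuallyEq ?_
        filter_upwards [hopenW x hx] with y hy using cutoffShift_of_mem hy w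
    · refine (contMDiff_subtype_val (I := I)).contMDiffAt.congr_of_eventuallyEq ?_
      filter_upwards [hout x hx] with y hy using hy t
  set q : ℝ → C^∞⟮I, V; I, M⟯ := fun t => ⟨cutoffShift Φ χ (α t), hsmooth t⟩ with hq
  have hqE : ∀ t, q t ∈ endo I F D Φ V := by
    refine fun t => ⟨fun x y hy => ?_, fun z hz => ?_⟩
    · by_cases hyW : (y : M) ∈ W
      · change cutoffShift Φ χ (α t) y ∈ _
        rw [cutoffShift_of_mem hyW w]
        exact hΦ.mem_orbit_trans hy ⟨_, hmem t y hyW, rfl⟩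
      · change cutoffShift Φ χ (α t) y ∈ _
        rwa [(hout y hyW).self_of_nhds t]
    · by_cases hzW : (z : M) ∈ W
      · refine (isLocalDiffeomorphAt_inclusion_iff hWV (z := ⟨z, hzW⟩) (g := p t) ?_).1
          ((hpE t).2 ⟨z, hzW⟩ hz)
        have hc : Tendsto (TopologicalSpace.Opens.inclusion hWV) (𝓝 ⟨z, hzW⟩) (𝓝 z) :=
          (contMDiff_inclusion (I := I) (n := ∞) hWV).continuous.continuousAt
        filter_upwards [hc.eventually (hsing z hzW hz)] with x hx
        refine Eq.trans ?_ (hx t).symm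
        rw [retract_of_mem w (x := TopologicalSpace.Opens.inclusion hWV x) x.2]
      · refine isLocalDiffeomorphAt_congr (hVid.2 z hz) ?_
        filter_upwards [hout z hzW] with y hy using hy t
  have hqc : letI := weakTopology I V I M k; Continuous q := by
    refine continuous_weakTopology fun l hl t₀ x₀ φ hφ ψ hψ hx hy => ?_
    by_cases hxW : (x₀ : M) ∈ W
    · have hlim : Tendsto (fun r : ℝ × V => r.2) (𝓝 (t₀, x₀)) (𝓝 x₀) :=
        continuous_snd.continuousAt
      by_cases hxs : (x₀ : M) ∈ singularSet I F
      · have hev : ∀ᶠ r : ℝ × V in 𝓝 (t₀, x₀),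
            q r.1 r.2 = p r.1 (retract V w r.2) := by
          filter_upwards [hlim.eventually (hsing x₀ hxW hxs)] with r hr using hr r.1
        exact (MFamilyAt.comp (Q := Prod.snd) (IsManifold.chart_mem_maximalAtlas _)
          (IsManifold.chart_mem_maximalAtlas _) hφ hψ (hfam l hl t₀ (retract V w x₀))
          (contMDiffAt_retract w hxW) contMDiffAt_snd (mem_chart_source _ _)
          (mem_chart_source _ _) hx (hev.self_of_nhds ▸ hy)).congr hev hx
      · have hr : ((retract V w x₀ : W) : M) ∉ singularSet I F := by
          rwa [retract_of_mem w hxW]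
        obtain ⟨U, τ, hU, hpU, hloc⟩ := hαloc t₀ (retract V w x₀) hr
        have hrs := contMDiffAt_retract (I := I) w hxW
        have hτ : ContMDiffAt I 𝓘(ℝ, ℝ) ∞ τ (p t₀ (retract V w x₀)) :=
          hU.contMDiffOn.contMDiffAt (hU.isOpen.mem_nhds hpU)
        have hlim' : Tendsto (fun r : ℝ × V => (r.1, retract V w r.2)) (𝓝 (t₀, x₀))
            (𝓝 (t₀, retract V w x₀)) :=
          continuousAt_fst.prodMk (hrs.continuousAt.comp_of_eq continuousAt_snd rfl)
        -- The flow box formula freezes `α` at time `t₀`, so time enters only through the value of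
        -- `p`, and `q` is locally a fixed smooth map applied to the point and that value.
        have hev : ∀ᶠ r : ℝ × V in 𝓝 (t₀, x₀), q r.1 r.2 =
            Φ r.2 (χ r.2 * (α t₀ (retract V w r.2) + (τ (p t₀ (retract V w r.2)) -
              τ (p r.1 (retract V w r.2))))) := by
          filter_upwards [hlim.eventually (hopenW x₀ hxW), hlim'.eventually hloc] with r hr1 hr2
          rw [← hr2.2]
          exact cutoffShift_of_mem hr1 w
        have hQ : ContMDiffAt (I.prod I) I ∞ (fun r : V × M =>
            Φ r.1 (χ r.1 * (α t₀ (retract V w r.1) + (τ (p t₀ (retract V w r.1)) - τ r.2))))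
            (x₀, p t₀ (retract V w x₀)) := by
          have e1 : ContMDiffAt I 𝓘(ℝ, ℝ) ∞
              (fun y => α t₀ (retract V w y) + τ (p t₀ (retract V w y))) x₀ :=
            ((hαs t₀ _ hr).comp x₀ hrs).add
              (hτ.comp x₀ (((p t₀).contMDiff _).comp x₀ hrs))
          have e2 : ContMDiffAt (I.prod I) 𝓘(ℝ, ℝ) ∞ (fun r : V × M =>
              χ r.1 * (α t₀ (retract V w r.1) + τ (p t₀ (retract V w r.1)) - τ r.2))
              (x₀, p t₀ (retract V w x₀)) :=
            ((χ.contMDiff x₀).comp (x₀, p t₀ (retract V w x₀)) contMDiffAt_fst).mul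
              ((e1.comp (x₀, p t₀ (retract V w x₀)) contMDiffAt_fst).sub
                (hτ.comp (x₀, p t₀ (retract V w x₀)) contMDiffAt_snd))
          simp only [← add_sub_assoc]
          refine hΦ.contMDiffAt_shift (f := fun r : V × M => (r.1 : M))
            (contMDiff_subtype_val.contMDiffAt.comp _ contMDiffAt_fst) e2 ?_
          simpa using hmem t₀ x₀ hxW
        exact (MFamilyAt.comp (Q := fun r : V × M => Φ r.1 (χ r.1 * (α t₀ (retract V w r.1) +
            (τ (p t₀ (retract V w r.1)) - τ r.2)))) (IsManifold.chart_mem_maximalAtlas _)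
          (IsManifold.chart_mem_maximalAtlas _) hφ hψ (hfam l hl t₀ (retract V w x₀)) hrs hQ
          (mem_chart_source _ _) (mem_chart_source _ _) hx (hev.self_of_nhds ▸ hy)).congr hev hx
    · have hev : ∀ᶠ r : ℝ × V in 𝓝 (t₀, x₀), q r.1 r.2 = r.2 := by
        have hlim : Tendsto (fun r : ℝ × V => r.2) (𝓝 (t₀, x₀)) (𝓝 x₀) :=
          continuous_snd.continuousAt
        filter_upwards [hlim.eventually (hout x₀ hxW)] with r hr using hr r.1
      exact (MFamilyAt.const (f := fun y : V => (y : M)) hφ hψ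
        contMDiff_subtype_val.contMDiffAt hx (hev.self_of_nhds ▸ hy)).congr hev hx
  have hq0 : q 0 = inclusion I V := by
    ext x
    change cutoffShift Φ χ (α 0) x = x
    rw [cutoffShift]
    split_ifs
    · rw [hα0, mul_zero, hΦ.map_zero]
    · rfl
  obtain ⟨α', hα'D, hα'⟩ := hV (mem_endoId_of_path hqc hq0 rfl fun t _ => hqE t)
  set i : W → V := TopologicalSpace.Opens.inclusion hWV with hi
  have his : ContMDiff I I ∞ i := contMDiff_inclusion hWV
  -- `α'` realizes the cut-off shift on `V`; the remaining time `(1 - χ) α 1` vanishes near the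
  -- singular points, where `α 1` need not be smooth.
  have hβ : ContMDiff I 𝓘(ℝ, ℝ) ∞ fun x : W => α' (i x) + (1 - χ (i x)) * α 1 x := by
    intro x
    have e1 : ContMDiffAt I 𝓘(ℝ, ℝ) ∞ (fun x => α' (i x)) x := (α'.contMDiff _).comp x (his x)
    have e2 : ContMDiffAt I 𝓘(ℝ, ℝ) ∞ (fun x => χ (i x)) x := (χ.contMDiff _).comp x (his x)
    by_cases hxs : (x : M) ∈ singularSet I F
    · refine e1.congr_of_eventuallyEq ?_
      filter_upwards [his.continuous.continuousAt.eventually (h1 (i x) x.2 hxs)] with y hy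
      simp [hy]
    · exact e1.add ((contMDiffAt_const.sub e2).mul (hαs 1 x hxs))
  have hshift : ∀ x : W, ((x : M), α' (i x) + (1 - χ (i x)) * α 1 x) ∈ D ∧
      Φ x (α' (i x) + (1 - χ (i x)) * α 1 x) = h x := by
    intro x
    have hr : retract V w (i x) = x := retract_of_mem w (x := i x) x.2
    have e1 := hmem 1 (i x) x.2
    have e2 : Φ x (χ (i x) * α 1 x) = Φ x (α' (i x)) := by
      have := hα' (i x)
      change cutoffShift Φ χ (α 1) (i x) = _ at this
      rw [cutoffShift_of_mem (x := i x) x.2 w, hr] at this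
      exact this
    have e3 : χ (i x) * α 1 x + (1 - χ (i x)) * α 1 x = α 1 x := by ring
    rw [hr] at e1
    -- `α'` and `χ α 1` need not be equal: they only lead to the same point, from which the
    -- remaining time leads to `h x`.
    have := hΦ.shift_of_eq (s := (1 - χ (i x)) * α 1 x) e1 (hα'D (i x)) e2
      (by rw [e3]; exact (hαΦ 1 x).1)
    refine ⟨this.1, this.2.trans ?_⟩
    rw [e3, (hαΦ 1 x).2, hp1]
  exact ⟨⟨_, hβ⟩, fun x => (hshift x).1, fun x => (hshift x).2.symm⟩

end Main

end ShiftMap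

theorem mainTheorem10
    {E : Type*} [NormedAddCommGroup E] [NormedSpace ℝ E] [FiniteDimensional ℝ E]
    {H : Type*} [TopologicalSpace H] (I : ModelWithCorners ℝ E H)
    {M : Type*} [TopologicalSpace M] [ChartedSpace H M] [IsManifold I ∞ M]
    [T2Space M] [SecondCountableTopology M] [ConnectedSpace M]
    (F : (x : M) → TangentSpace I x)
    (hF : ContMDiff I I.tangent ∞ (fun x => (⟨x, F x⟩ : TangentBundle I M)))
    (D : Set (M × ℝ)) (Φ : M → ℝ → M) (hΦ : ShiftMap.IsLocalFlow I F D Φ)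
    (k : ℕ∞) (V W : TopologicalSpace.Opens M)
    (hV : IsConnected (V : Set M))
    (hVsing : IsNowhereDense {x : V | (x : M) ∈ ShiftMap.singularSet I F})
    (hVk : ShiftMap.shiftImage I D Φ V = ShiftMap.endoId I F D Φ V k)
    (hWV : W ≤ V)
    (hW : IsConnected (W : Set M))
    (hWsing : IsClosed
      {z : ↥((V : Set M) ∩ ShiftMap.singularSet I F) | (z : M) ∈ W}) :
    ShiftMap.shiftImage I D Φ W = ShiftMap.endoId I F D Φ W k := by
  have hVE : ShiftMap.shiftImage I D Φ V ⊆ ShiftMap.endo I F D Φ V :=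
    hVk.subset.trans ShiftMap.endoId_subset
  -- The inclusion is the shift by zero.
  have hVid : ShiftMap.inclusion I V ∈ ShiftMap.endo I F D Φ V :=
    hVE ⟨⟨fun _ => 0, contMDiff_const⟩, fun x => hΦ.zero_mem x, fun x => (hΦ.map_zero x).symm⟩
  exact Set.Subset.antisymm
    (ShiftMap.shiftImage_subset_endoId hΦ fun _ hh =>
      ShiftMap.mem_endo_of_shift hΦ hVE hWV hWsing hh)
    (ShiftMap.endoId_subset_shiftImage hΦ hVk.symm.subset hVid hWV hW.nonempty hWsing)
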